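/- \textbf{Setting.} Let $S$ be a compact Polish space and $(V_t)_{t\ge0}$ a càdlàg Feller (Markov) process on $S$ with respect to a right-continuous filtration $(\mathcal F_t)$, with laws $(\mathbb P_x)_{x\in S}$, $\mathbb P_x(V_0=x)=1$, and $\mathbb P_\nu=\int\mathbb P_y\,\nu(\mathrm dy)$. Assume that $(V_t)$ has a unique invariant probability measure $\pi$, and that there are constants $C_0,\delta>0$ such that for every $x\in S$ one can define on a common probability space $(\tilde\Omega,\tilde{\mathcal F},\tilde{\mathbb P})$ càdlàg processes $V^x$ and $V^\pi$, with the finite-dimensional distributions of $V$ under $\mathbb P_x$ and under $\mathbb P_\pi$ respectively, for which $T^x=\inf\{t\ge0: V^x_t=V^\pi_t\}$ is a stopping time and $\tilde{\mathbb P}(T^x\ge t)\le C_0e^{-\delta t}$ for all $t\ge0$. Let $f:\mathbb R^K\times S\to\mathbb R$ be continuous and $C^2$ in $\theta$, with $\nabla_\theta f$ and the Hessian $H_\theta f$ continuous on $\mathbb R^K\times S$, $\nabla_\theta f(\cdot,y)$ Lipschitz uniformly in $y$, and $f(\theta,\cdot),\nabla_\theta f(\theta,\cdot)$ $\pi$-integrable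 for every $\theta$. Assume uniform strong convexity: there is $\kappa>0$ with $\langle x_1-x_2,\nabla_\theta f(x_1,y)-\nabla_\theta f(x_2,y)\rangle\ge\kappa\|x_1-x_2\|^2$ for all $x_1,x_2\in\mathbb R^K$, $y\in S$. Put $\Phi(\theta)=\int_S f(\theta,y)\,\pi(\mathrm dy)$, and let $$\mathcal W_d(\nu,\nu')=\inf_\Gamma\int (1\wedge\|y-y'\|)\,\Gamma(\mathrm dy,\mathrm dy'),$$ the infimum being over all couplings $\Gamma$ of the probability measures $\nu,\nu'$ on $\mathbb R^K$. For $\varepsilon>0$, the constant-rate process is the solution of $\mathrm d\theta^\varepsilon_t=-\nabla_\theta f(\theta^\varepsilon_t,V_{t/\varepsilon})\,\mathrm dt$. For a function $\mu:[0,\infty)\to(0,\infty)$, the decreasing-rate process (SGPD) started at $\theta_0\in\mathbb R^K$ is the solution of $\mathrm d\xi_t=-\nabla_\theta f(\xi_t,V_{\beta(t)})\,\mathrm dt$, $\xi_0=\theta_0$, where $\beta(t)=\int_0^t\mu(s)\,\mathrm ds$; its law at time $t$ is denoted $D_t(\cdot|\theta_0,\pi)$ under $\mathbb P_\pi$ and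 $D_t(\cdot|\theta_0,a)$ under $\mathbb P_a$, $a\in S$. \textbf{Theorem.} $\Phi$ has a unique minimizer $\theta_*$. There is a function $\rho:(0,1)\to[0,1]$ with $\lim_{\varepsilon\to0}\rho(\varepsilon)=0$, depending only on $f$ and the index process, such that $\mathcal W_d(\Pi^\varepsilon(\cdot\times S),\delta_{\theta_*})\le\rho(\varepsilon)$ for every $\varepsilon\in(0,1)$ and every stationary probability measure $\Pi^\varepsilon$ of $(\theta^\varepsilon_t,V_{t/\varepsilon})_{t\ge0}$, and such that the following holds. Let $\mu:[0,\infty)\to(0,\infty)$ be non-decreasing and continuously differentiable with $\mu(t)\to\infty$ and $\mu'(t)t/\mu(t)\to0$ as $t\to\infty$, and put $$A(t)=\exp\Big(-\frac{\kappa t}{8}\Big)+\Big[\frac{\mu(t)-\mu(t/2)}{\mu(t)}\Big]^{1/2}+\rho\Big(\frac1{\mu(t/2)}\Big),$$ which is defined for all large $t$. Then $\lim_{t\to\infty}A(t)=0$, and for every $\theta_0\in\mathbb R^K$ there is a constant $C>0$ (depending on $f$, the index process, $\theta_0$ and $\mu$, but not on $a$ or $t$) such that for every $a\in S$ there is $T>0$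 with $$\mathcal W_d\big(D_t(\cdot|\theta_0,\pi),\delta_{\theta_*}\big)\le C\,A(t),\qquad \mathcal W_d\big(D_t(\cdot|\theta_0,a),\delta_{\theta_*}\big)\le C\,A(t)\qquad\text{for all }t>T.$$ -/

import Mathlib

open MeasureTheory ProbabilityTheory Filter Topology
open scoped NNReal ENNReal

universe u v w

noncomputable section

namespace SGP

/-- Right-continuous paths with left limits on `[0, ∞)`. -/
def IsCadlag {S : Type*} [TopologicalSpace S] (w : ℝ≥0 → S) : Prop :=
  ∀ t, ContinuousWithinAt w (Set.Ici t) t ∧ ∃ l, Tendsto w (𝓝[<] t) (𝓝 l)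

/-- `(V_t)` is a càdlàg Feller process with respect to the right-continuous filtration `𝓕`, under
the family of laws `(P x)`, where `P x` is the law of the process started in `x`: it is adapted,
starts in `x`, has the homogeneous Markov property with respect to `𝓕`, and its transition
operators `h ↦ E_x[h(V_t)]` preserve continuity. (Strong continuity at `t = 0` follows from the
right-continuity of the paths.) Taking for `Ω` the càdlàg path space and for `V` the coordinate
process gives the canonical setting. -/
structure IsFellerProcess {S Ω : Type*} [TopologicalSpace S] [MeasurableSpace S]
    [mΩ : MeasurableSpace Ω] (𝓕 : Filtration ℝ≥0 mΩ) (P : Kernel S Ω) (V : ℝ≥0 → Ω → S) :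
    Prop where
  rightCont : 𝓕.IsRightContinuous
  isProb : IsMarkovKernel P
  adapted : ∀ t, Measurable[𝓕 t] (V t)
  cadlag : ∀ ω, IsCadlag fun t => V t ω
  start : ∀ x, P x {ω | V 0 ω = x} = 1
  markov : ∀ (x : S) (s t : ℝ≥0) (A : Set S), MeasurableSet A →
    (P x)[(V (s + t) ⁻¹' A).indicator (fun _ => (1 : ℝ)) | 𝓕 s]
      =ᵐ[P x] fun ω => (P (V s ω)).real (V t ⁻¹' A)
  feller : ∀ (t : ℝ≥0) (h : C(S, ℝ)), Continuous fun x => ∫ ω, h (V t ω) ∂(P x)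

/-- The law `P_ν = ∫ P_y ν(dy)` of the process with initial distribution `ν`. -/
def lawFrom {S Ω : Type*} [MeasurableSpace S] [MeasurableSpace Ω] (P : Kernel S Ω)
    (ν : Measure S) : Measure Ω :=
  ν.bind P

/-- The probability measure `ν` is invariant for the process: `P_ν(V_t ∈ ·) = ν` for all `t`. -/
def IsInvariantFor {S Ω : Type*} [MeasurableSpace S] [MeasurableSpace Ω] (P : Kernel S Ω)
    (V : ℝ≥0 → Ω → S) (ν : Measure S) : Prop :=
  IsProbabilityMeasure ν ∧ ∀ t, (lawFrom P ν).map (V t) = ν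

/-- Equality in law of two processes, in the sense of finite-dimensional distributions. -/
def SameFDD {S Ω Ω' : Type*} [MeasurableSpace S] [MeasurableSpace Ω] [MeasurableSpace Ω']
    (Q : Measure Ω) (V : ℝ≥0 → Ω → S) (Q' : Measure Ω') (V' : ℝ≥0 → Ω' → S) : Prop :=
  ∀ (n : ℕ) (t : Fin n → ℝ≥0) (A : Fin n → Set S), StrictMono t → (∀ i, MeasurableSet (A i)) →
    Q {ω | ∀ i, V (t i) ω ∈ A i} = Q' {ω | ∀ i, V' (t i) ω ∈ A i}

/-- First meeting time `inf {t ≥ 0 | X_t = Y_t}` of two processes (`∞` if they never meet). -/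
def meetingTime {S Ω : Type*} (X Y : ℝ≥0 → Ω → S) (ω : Ω) : ℝ≥0∞ :=
  ⨅ (t : ℝ≥0) (_ : X t ω = Y t ω), (t : ℝ≥0∞)

/-- The standing assumption on the index process: it is Feller, `π` is its unique invariant
measure, and for each `x` a copy started in `x` and a stationary copy can be realized on a common
probability space so that their meeting time is a stopping time with an exponential tail, uniformly
in `x`. -/
structure IndexProcessAssumption {S : Type u} {Ω : Type v} [TopologicalSpace S]
    [MeasurableSpace S] [mΩ : MeasurableSpace Ω] (𝓕 : Filtration ℝ≥0 mΩ) (P : Kernel S Ω)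
    (V : ℝ≥0 → Ω → S) (π : Measure S) : Prop where
  feller : IsFellerProcess 𝓕 P V
  invariant : IsInvariantFor P V π
  unique : ∀ ν : Measure S, IsInvariantFor P V ν → ν = π
  coupling : ∃ C > (0 : ℝ), ∃ δ > (0 : ℝ), ∀ x : S,
    ∃ (Ω' : Type w) (mΩ' : MeasurableSpace Ω') (Q : Measure Ω') (𝓖 : Filtration ℝ≥0 mΩ')
      (X Y : ℝ≥0 → Ω' → S),
      IsProbabilityMeasure Q ∧
      (∀ t, Measurable[𝓖 t] (X t)) ∧ (∀ t, Measurable[𝓖 t] (Y t)) ∧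
      (∀ ω, IsCadlag fun t => X t ω) ∧ (∀ ω, IsCadlag fun t => Y t ω) ∧
      SameFDD Q X (P x) V ∧ SameFDD Q Y (lawFrom P π) V ∧
      IsStoppingTime 𝓖 (meetingTime X Y) ∧
      ∀ t : ℝ≥0, Q {ω | (t : ℝ≥0∞) ≤ meetingTime X Y ω} ≤ ENNReal.ofReal (C * Real.exp (-δ * t))

/-- The gradient `∇_θ f(θ, y)` in the first variable. -/
def gradθ {S : Type*} {K : ℕ} (f : EuclideanSpace ℝ (Fin K) → S → ℝ)
    (θ : EuclideanSpace ℝ (Fin K)) (y : S) : EuclideanSpace ℝ (Fin K) :=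
  gradient (fun z => f z y) θ

/-- Regularity of the subsampled target function: `f` is continuous and twice continuously
differentiable in `θ`, with `∇_θ f` and the Hessian jointly continuous in `(θ, y)`; `∇_θ f` is
Lipschitz in `θ` uniformly in `y`; `f(θ, ·)` and `∇_θ f(θ, ·)` are `π`-integrable. -/
structure TargetAssumption {S : Type*} [TopologicalSpace S] [MeasurableSpace S] {K : ℕ}
    (f : EuclideanSpace ℝ (Fin K) → S → ℝ) (π : Measure S) : Prop where
  cont : Continuous fun p : EuclideanSpace ℝ (Fin K) × S => f p.1 p.2
  contDiff : ∀ y, ContDiff ℝ 2 fun θ => f θ y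
  cont_grad : Continuous fun p : EuclideanSpace ℝ (Fin K) × S => gradθ f p.1 p.2
  cont_hess : Continuous fun p : EuclideanSpace ℝ (Fin K) × S =>
    fderiv ℝ (fun θ => gradθ f θ p.2) p.1
  lipschitz : ∃ L : ℝ≥0, ∀ y, LipschitzWith L fun θ => gradθ f θ y
  integrable : ∀ θ, Integrable (f θ) π
  integrable_grad : ∀ θ, Integrable (gradθ f θ) π

/-- Strong convexity of `f(·, y)` with a parameter `κ` that does not depend on `y`. -/
def UniformlyStronglyConvex {S : Type*} {K : ℕ} (f : EuclideanSpace ℝ (Fin K) → S → ℝ)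
    (κ : ℝ) : Prop :=
  ∀ (y : S) (x₁ x₂ : EuclideanSpace ℝ (Fin K)),
    κ * ‖x₁ - x₂‖ ^ 2 ≤ inner ℝ (x₁ - x₂) (gradθ f x₁ y - gradθ f x₂ y)

/-- The full target function `Φ(θ) = ∫ f(θ, y) π(dy)`. -/
def fullTarget {S : Type*} [MeasurableSpace S] {K : ℕ} (f : EuclideanSpace ℝ (Fin K) → S → ℝ)
    (π : Measure S) (θ : EuclideanSpace ℝ (Fin K)) : ℝ :=
  ∫ y, f θ y ∂π

/-- Assumption on the rate function `μ : [0, ∞) → (0, ∞)` (values at negative arguments are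
irrelevant). -/
structure RateAssumption (μ : ℝ → ℝ) : Prop where
  pos : ∀ t, 0 ≤ t → 0 < μ t
  mono : MonotoneOn μ (Set.Ici 0)
  contDiff : ContDiffOn ℝ 1 μ (Set.Ici 0)
  tendsto : Tendsto μ atTop atTop
  slow : Tendsto (fun t => derivWithin μ (Set.Ici 0) t * t / μ t) atTop (𝓝 0)

/-- The rescaled time `β(t) = ∫₀ᵗ μ(s) ds`. -/
def rescaledTime (μ : ℝ → ℝ) (t : ℝ≥0) : ℝ≥0 :=
  (∫ s in (0 : ℝ)..t, μ s).toNNReal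

/-- `ξ` is a (strong) solution of `dξ_t = -∇_θ f(ξ_t, V_{τ(t)}) dt`, `ξ_0 = θ₀`, where `τ` is a
time change: it has continuous paths, satisfies the integrated equation and `ξ_t` is measurable
with respect to `𝓕_{τ(t)}`. -/
structure IsGradientProcess {S Ω : Type*} [mΩ : MeasurableSpace Ω] {K : ℕ}
    (𝓕 : Filtration ℝ≥0 mΩ) (V : ℝ≥0 → Ω → S) (f : EuclideanSpace ℝ (Fin K) → S → ℝ)
    (τ : ℝ≥0 → ℝ≥0) (θ₀ : EuclideanSpace ℝ (Fin K)) (ξ : ℝ≥0 → Ω → EuclideanSpace ℝ (Fin K)) :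
    Prop where
  adapted : ∀ t, Measurable[𝓕 (τ t)] (ξ t)
  cont : ∀ ω, Continuous fun t => ξ t ω
  eqn : ∀ ω (t : ℝ≥0),
    ξ t ω = θ₀ - ∫ s in (0 : ℝ)..t, gradθ f (ξ s.toNNReal ω) (V (τ s.toNNReal) ω)

/-- Stochastic gradient process with constant learning rate: index process `V_{t/ε}`. -/
def IsSGPC {S Ω : Type*} [mΩ : MeasurableSpace Ω] {K : ℕ} (𝓕 : Filtration ℝ≥0 mΩ)
    (V : ℝ≥0 → Ω → S) (f : EuclideanSpace ℝ (Fin K) → S → ℝ) (ε : ℝ)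
    (θ₀ : EuclideanSpace ℝ (Fin K)) (θ : ℝ≥0 → Ω → EuclideanSpace ℝ (Fin K)) : Prop :=
  IsGradientProcess 𝓕 V f (fun t => t / ε.toNNReal) θ₀ θ

/-- Stochastic gradient process with decreasing learning rate: index process `V_{β(t)}`. -/
def IsSGPD {S Ω : Type*} [mΩ : MeasurableSpace Ω] {K : ℕ} (𝓕 : Filtration ℝ≥0 mΩ)
    (V : ℝ≥0 → Ω → S) (f : EuclideanSpace ℝ (Fin K) → S → ℝ) (μ : ℝ → ℝ)
    (θ₀ : EuclideanSpace ℝ (Fin K)) (ξ : ℝ≥0 → Ω → EuclideanSpace ℝ (Fin K)) : Prop :=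
  IsGradientProcess 𝓕 V f (rescaledTime μ) θ₀ ξ

/-- The probability measure `Pst` on `ℝ^K × S` is stationary for the coupled Markov process
`(θ^ε_t, V_{t/ε})`. -/
def IsStationarySGPC {S Ω : Type*} [MeasurableSpace S] [mΩ : MeasurableSpace Ω] {K : ℕ}
    (𝓕 : Filtration ℝ≥0 mΩ) (P : Kernel S Ω) (V : ℝ≥0 → Ω → S)
    (f : EuclideanSpace ℝ (Fin K) → S → ℝ) (ε : ℝ)
    (Pst : Measure (EuclideanSpace ℝ (Fin K) × S)) : Prop :=
  IsProbabilityMeasure Pst ∧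
  ∃ θ : EuclideanSpace ℝ (Fin K) → ℝ≥0 → Ω → EuclideanSpace ℝ (Fin K),
    (∀ m, IsSGPC 𝓕 V f ε m (θ m)) ∧
    ∀ (t : ℝ≥0) (B : Set (EuclideanSpace ℝ (Fin K) × S)), MeasurableSet B →
      Pst B = ∫⁻ z, P z.2 {ω | (θ z.1 t ω, V (t / ε.toNNReal) ω) ∈ B} ∂Pst

/-- The Wasserstein distance on `ℝ^K` for the bounded metric `d(y, y') = 1 ∧ ‖y - y'‖`. -/
def wasserstein {K : ℕ} (ν ν' : Measure (EuclideanSpace ℝ (Fin K))) : ℝ≥0∞ :=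
  ⨅ (Γ : Measure (EuclideanSpace ℝ (Fin K) × EuclideanSpace ℝ (Fin K)))
    (_ : IsProbabilityMeasure Γ ∧ Γ.map Prod.fst = ν ∧ Γ.map Prod.snd = ν'),
    ∫⁻ p, ENNReal.ofReal (min 1 ‖p.1 - p.2‖) ∂Γ

/-- The rate `A(t) = e^{-κt/8} + [(μ(t) - μ(t/2))/μ(t)]^{1/2} + ρ(1/μ(t/2))`. -/
def rateA (κ : ℝ) (μ ρ : ℝ → ℝ) (t : ℝ) : ℝ :=
  Real.exp (-κ * t / 8) + Real.sqrt ((μ t - μ (t / 2)) / μ t) + ρ (1 / μ (t / 2))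

end SGP

end

set_option linter.unusedSectionVars false

noncomputable section

namespace SGP

/-! The proof is a mean-square energy estimate driven by averaging. Integrating the strong convexity
inequality makes the mean gradient strongly monotone and Lipschitz, so it has a zero `θstar`. The
same convexity makes `θstar` the only minimizer. Put `G = gradθ f θstar`, which is centred under
`π`.

Along any gradient path, strong convexity gives `d/dt ‖ξ - θstar‖² ≤ -2κ ‖ξ - θstar‖² - 2 ⟪ξ -
θstar, G(V)⟫`. The random forcing thus enters only through `G`, independently of the current
position. It is bounded, so paths enter a ball around `θstar` of radius independent of the starting
point. It averages out: by a Krylov–Bogoliubov argument (`exists_forall_abs_average_sub_lt`),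
uniqueness of `π` makes the time averages of `E_x[G(V_u)]` over windows of length at least `L`
smaller than some `R L → 0`, uniformly in `x`.

Slow time is cut into blocks of length `h`. On a block `ξ` is frozen at its initial value, at a cost
of order `h²` (`norm_sq_step_le`). The Markov property turns the correlation of the frozen vector
with `G(V)` into an average of transition operators (`abs_integral_inner_integral_le`). A block of
slow length `h` lasts about `h m` in fast time, `m` being the rate of the time change, so this
average is governed by `R` and by the relative variation of `m`
(`norm_integral_transition_timeChange_le`). Each step contracts by `1 - 2κh`, and iterating gives
`exists_integral_norm_sq_le`: the mean square is at most a constant times `exp(-2κnh) + h + relative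
increment of m + R L`.

With `h` of order `√ε` and `L` of order `1/√ε`, the part surviving at constant rate is `b ε = √ε +
R(const/√ε)`. For stationary laws Chebyshev's inequality yields a bound of order `b^(1/3)`, which
defines `ρ`. For the decreasing-rate process the estimate is applied on `[t/2, t]` with `ε =
1/μ(t/2)`. A square root then gives the rate `A(t)`. Everything is uniform in the starting point of
the index process, so the stationary start follows by integration. -/

/-- A process with right-continuous paths is jointly measurable. -/
theorem measurable_uncurry_of_rightCont {α E : Type*} [MeasurableSpace α] [TopologicalSpace E]
    [TopologicalSpace.PseudoMetrizableSpace E] [MeasurableSpace E] [BorelSpace E]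
    {X : ℝ≥0 → α → E} (hX : ∀ t, Measurable (X t))
    (hc : ∀ a t, ContinuousWithinAt (fun s => X s a) (Set.Ici t) t) :
    Measurable (Function.uncurry X) := by
  -- The grid point strictly to the right of `t`: each `q n` takes countably many values, and `q n t
  -- → t` from the side where paths are continuous.
  let q : ℕ → ℝ≥0 → ℝ≥0 := fun n t => ((⌊t * (n + 1 : ℝ≥0)⌋₊ : ℝ≥0) + 1) / (n + 1)
  have hq : ∀ t, Tendsto (fun n => q n t) atTop (𝓝[≥] t) := by
    intro t
    have hle : ∀ n, t ≤ q n t := fun n => by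
      rw [le_div_iff₀ (by positivity)]
      exact (Nat.lt_floor_add_one _).le
    refine tendsto_nhdsWithin_iff.2 ⟨?_, Eventually.of_forall hle⟩
    refine tendsto_of_tendsto_of_tendsto_of_le_of_le (g := fun _ => t)
      (h := fun n : ℕ => t + 1 / ((n : ℝ≥0) + 1)) tendsto_const_nhds ?_ hle ?_
    · have := (tendsto_one_div_add_atTop_nhds_zero_nat (𝕜 := ℝ≥0)).const_add t
      simpa using this
    · intro n
      have hpos : (0 : ℝ≥0) < n + 1 := by positivity
      change ((⌊t * (n + 1 : ℝ≥0)⌋₊ : ℝ≥0) + 1) / (n + 1) ≤ t + 1 / ((n : ℝ≥0) + 1)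
      rw [add_div]
      gcongr
      rw [div_le_iff₀ hpos]
      exact Nat.floor_le (by positivity)
  refine measurable_of_tendsto_metrizable (f := fun n p => X (q n p.1) p.2) (fun n => ?_) ?_
  · have h1 : Measurable fun p : ℕ × α => X (((p.1 : ℝ≥0) + 1) / (n + 1)) p.2 :=
      measurable_from_prod_countable_right fun k => hX (((k : ℝ≥0) + 1) / (n + 1))
    have h2 : Measurable fun p : ℝ≥0 × α => (⌊p.1 * (n + 1 : ℝ≥0)⌋₊, p.2) :=
      (Nat.measurable_floor.comp (measurable_fst.mul_const _)).prodMk measurable_snd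
    have h3 := h1.comp h2
    simpa only [Function.comp_def] using h3
  · rw [tendsto_pi_nhds]
    rintro ⟨t, a⟩
    exact (hc a t).tendsto.comp (hq t)

theorem exists_norm_le {S E : Type*} [TopologicalSpace S] [CompactSpace S]
    [NormedAddCommGroup E] {h : S → E} (hh : Continuous h) : ∃ B, 0 ≤ B ∧ ∀ y, ‖h y‖ ≤ B := by
  obtain ⟨B, hB⟩ := (isCompact_range hh.norm).bddAbove
  exact ⟨max B 0, le_max_right _ _, fun y => (hB ⟨y, rfl⟩).trans (le_max_left _ _)⟩

theorem integrable_of_continuous_compactSpace {S E : Type*} [TopologicalSpace S] [CompactSpace S]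
    [MeasurableSpace S] [BorelSpace S] [NormedAddCommGroup E] [SecondCountableTopology E]
    {h : S → E} (hh : Continuous h) (m : Measure S) [IsFiniteMeasure m] : Integrable h m := by
  borelize E
  obtain ⟨B, -, hB⟩ := exists_norm_le hh
  exact Integrable.of_bound hh.measurable.aestronglyMeasurable B (Eventually.of_forall hB)

theorem integral_bind_kernel {α β E : Type*} [MeasurableSpace α] [MeasurableSpace β]
    [NormedAddCommGroup E] [NormedSpace ℝ E] {m : Measure α} [SFinite m] {κ : Kernel α β}
    [IsSFiniteKernel κ] {h : β → E} (hh : Integrable h (m.bind κ)) :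
    ∫ y, h y ∂(m.bind κ) = ∫ x, ∫ y, h y ∂(κ x) ∂m := by
  rw [Measure.comp_eq_comp_const_apply] at hh ⊢
  rw [Kernel.integral_comp hh, Kernel.const_apply]

/-- The transition operators `(t, x) ↦ E_x[h(V_t)]`. -/
def transition {S Ω E : Type*} [MeasurableSpace S] [MeasurableSpace Ω] [NormedAddCommGroup E]
    [NormedSpace ℝ E] (P : Kernel S Ω) (V : ℝ≥0 → Ω → S) (h : S → E) (t : ℝ≥0) (x : S) : E :=
  ∫ ω, h (V t ω) ∂(P x)

/-! ### Transition operators and the integrated Markov property. -/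

section Transition

variable {S : Type u} {Ω : Type v} [TopologicalSpace S] [PolishSpace S]
    [CompactSpace S] [MeasurableSpace S] [BorelSpace S] [mΩ : MeasurableSpace Ω]
    {𝓕 : Filtration ℝ≥0 mΩ} {P : Kernel S Ω} {V : ℝ≥0 → Ω → S}
    {E : Type*} [NormedAddCommGroup E] [NormedSpace ℝ E]

theorem IsFellerProcess.measurable (hV : IsFellerProcess 𝓕 P V) (t : ℝ≥0) : Measurable (V t) :=
  (hV.adapted t).mono (𝓕.le t) le_rfl

theorem IsFellerProcess.measurable_uncurry (hV : IsFellerProcess 𝓕 P V) :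
    Measurable (Function.uncurry V) :=
  measurable_uncurry_of_rightCont hV.measurable fun ω t => (hV.cadlag ω t).1

variable [SecondCountableTopology E]

theorem IsFellerProcess.integrable_comp (hV : IsFellerProcess 𝓕 P V) {h : S → E}
    (hh : Continuous h) (t : ℝ≥0) (Q : Measure Ω) [IsFiniteMeasure Q] :
    Integrable (fun ω => h (V t ω)) Q := by
  borelize E
  obtain ⟨B, -, hB⟩ := exists_norm_le hh
  exact Integrable.of_bound (hh.measurable.comp (hV.measurable t)).aestronglyMeasurable B
    (Eventually.of_forall fun ω => hB _)

theorem IsFellerProcess.norm_transition_le (hV : IsFellerProcess 𝓕 P V) {h : S → E} {B : ℝ}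
    (hB : ∀ y, ‖h y‖ ≤ B) (t : ℝ≥0) (x : S) : ‖transition P V h t x‖ ≤ B := by
  have := hV.isProb
  have h1 := norm_integral_le_of_norm_le_const (μ := P x)
    (Eventually.of_forall fun ω => hB (V t ω))
  rwa [probReal_univ, mul_one] at h1

theorem IsFellerProcess.measurable_transition [MeasurableSpace E] [BorelSpace E]
    [CompleteSpace E] (hV : IsFellerProcess 𝓕 P V)
    {h : S → E} (hh : Continuous h) (t : ℝ≥0) : Measurable (transition P V h t) := by
  have := hV.isProb
  have h1 : StronglyMeasurable (Function.uncurry fun (_ : S) ω => h (V t ω)) :=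
    ((hh.measurable.comp (hV.measurable t)).comp measurable_snd).stronglyMeasurable
  exact (h1.integral_kernel_prod_right' (κ := P)).measurable

theorem IsFellerProcess.rightCont_transition (hV : IsFellerProcess 𝓕 P V)
    {h : S → E} (hh : Continuous h) (x : S) (t : ℝ≥0) :
    ContinuousWithinAt (fun s => transition P V h s x) (Set.Ici t) t := by
  borelize E
  have := hV.isProb
  obtain ⟨B, -, hB⟩ := exists_norm_le hh
  refine tendsto_integral_filter_of_dominated_convergence (fun _ => B) ?_ ?_ (integrable_const B) ?_
  · exact Eventually.of_forall fun s =>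
      (hh.measurable.comp (hV.measurable s)).aestronglyMeasurable
  · exact Eventually.of_forall fun s => Eventually.of_forall fun ω => hB _
  · exact Eventually.of_forall fun ω => (hh.tendsto _).comp (hV.cadlag ω t).1

theorem IsFellerProcess.measurable_uncurry_transition [MeasurableSpace E] [BorelSpace E]
    [CompleteSpace E] (hV : IsFellerProcess 𝓕 P V)
    {h : S → E} (hh : Continuous h) : Measurable (Function.uncurry (transition P V h)) :=
  measurable_uncurry_of_rightCont (hV.measurable_transition hh) (hV.rightCont_transition hh)

/-- Markov property integrated against a nonnegative bounded weight, as an identity of measures. -/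
theorem IsFellerProcess.map_withDensity (hV : IsFellerProcess 𝓕 P V) (x : S) (s t : ℝ≥0)
    {Z : Ω → ℝ} (hZ : Measurable[𝓕 s] Z) (h0 : ∀ ω, 0 ≤ Z ω) {B : ℝ} (hB : ∀ ω, Z ω ≤ B) :
    ((P x).withDensity fun ω => ENNReal.ofReal (Z ω)).map (V (s + t)) =
      (((P x).withDensity fun ω => ENNReal.ofReal (Z ω)).map (V s)).bind (P.map (V t)) := by
  have := hV.isProb
  have hZm : Measurable Z := hZ.mono (𝓕.le s) le_rfl
  ext A hA
  have hVt : MeasurableSet (V t ⁻¹' A) := hV.measurable t hA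
  have hVst : MeasurableSet (V (s + t) ⁻¹' A) := hV.measurable (s + t) hA
  rw [Measure.bind_apply hA (Kernel.measurable _).aemeasurable,
    lintegral_map (Kernel.measurable_coe _ hA) (hV.measurable s),
    Measure.map_apply (hV.measurable _) hA, withDensity_apply _ hVst,
    lintegral_withDensity_eq_lintegral_mul _ hZm.ennreal_ofReal
      (g := fun ω => P.map (V t) (V s ω) A)
      ((Kernel.measurable_coe _ hA).comp (hV.measurable s))]
  have hZi : Integrable Z (P x) := Integrable.of_bound hZm.aestronglyMeasurable B
    (Eventually.of_forall fun ω => by rw [Real.norm_of_nonneg (h0 ω)]; exact hB ω)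
  have hind : Integrable ((V (s + t) ⁻¹' A).indicator fun _ => (1 : ℝ)) (P x) :=
    (integrable_const _).indicator hVst
  have hprod : Integrable (Z * (V (s + t) ⁻¹' A).indicator fun _ => (1 : ℝ)) (P x) := by
    refine (hZi.indicator hVst).congr (Eventually.of_forall fun ω => ?_)
    by_cases h : ω ∈ V (s + t) ⁻¹' A <;> simp [h]
  -- The weight is `𝓕 s`-measurable, so it can be pulled out of the conditional expectation.
  have hce := condExp_mul_of_stronglyMeasurable_left (m := 𝓕 s) hZ.stronglyMeasurable hprod hind
  have hint : ∫ ω, (Z * (V (s + t) ⁻¹' A).indicator fun _ => (1 : ℝ)) ω ∂(P x) =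
      ∫ ω, Z ω * (P (V s ω)).real (V t ⁻¹' A) ∂(P x) := by
    rw [← integral_condExp (𝓕.le s)]
    refine integral_congr_ae (hce.trans ?_)
    filter_upwards [hV.markov x s t A hA] with ω hω
    simp [hω]
  have hreal : Measurable fun ω => (P (V s ω)).real (V t ⁻¹' A) :=
    ((Kernel.measurable_coe P hVt).comp (hV.measurable s)).ennreal_toReal
  have hint2 : Integrable (fun ω => Z ω * (P (V s ω)).real (V t ⁻¹' A)) (P x) := by
    refine hZi.mono (hZm.mul hreal).aestronglyMeasurable (Eventually.of_forall fun ω => ?_)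
    rw [norm_mul]
    refine mul_le_of_le_one_right (norm_nonneg _) ?_
    rw [Real.norm_of_nonneg measureReal_nonneg]
    exact measureReal_le_one
  have key := congrArg ENNReal.ofReal hint
  rw [ofReal_integral_eq_lintegral_ofReal hprod (Eventually.of_forall fun ω =>
      mul_nonneg (h0 ω) (Set.indicator_nonneg (fun _ _ => zero_le_one) _)),
    ofReal_integral_eq_lintegral_ofReal hint2 (Eventually.of_forall fun ω =>
      mul_nonneg (h0 ω) measureReal_nonneg)] at key
  rw [← lintegral_indicator hVst]
  convert key using 2
  · ext ω
    by_cases h : ω ∈ V (s + t) ⁻¹' A <;> simp [h]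
  · ext ω
    simp [ENNReal.ofReal_mul (h0 ω), Kernel.map_apply' _ (hV.measurable t) _ hA]

/-- Markov property in integrated form. -/
theorem IsFellerProcess.integral_mul_comp (hV : IsFellerProcess 𝓕 P V) (x : S) (s t : ℝ≥0)
    {Z : Ω → ℝ} (hZ : Measurable[𝓕 s] Z) {B : ℝ} (hB : ∀ ω, |Z ω| ≤ B) {h : S → ℝ}
    (hh : Continuous h) :
    ∫ ω, Z ω * h (V (s + t) ω) ∂(P x) = ∫ ω, Z ω * transition P V h t (V s ω) ∂(P x) := by
  have := hV.isProb
  have hnonneg : ∀ {Z : Ω → ℝ} (_ : Measurable[𝓕 s] Z) (_ : ∀ ω, 0 ≤ Z ω) {B : ℝ}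
      (_ : ∀ ω, Z ω ≤ B), ∫ ω, Z ω * h (V (s + t) ω) ∂(P x) =
        ∫ ω, Z ω * transition P V h t (V s ω) ∂(P x) := by
    intro Z hZ h0 B hB
    have hZm : Measurable Z := hZ.mono (𝓕.le s) le_rfl
    have hZi : Integrable Z (P x) := Integrable.of_bound hZm.aestronglyMeasurable B
      (Eventually.of_forall fun ω => by rw [Real.norm_of_nonneg (h0 ω)]; exact hB ω)
    have hfin : IsFiniteMeasure ((P x).withDensity fun ω => ENNReal.ofReal (Z ω)) :=
      isFiniteMeasure_withDensity_ofReal hZi.2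
    have hdens : ∀ g : Ω → ℝ, ∫ ω, g ω ∂((P x).withDensity fun ω => ENNReal.ofReal (Z ω)) =
        ∫ ω, Z ω * g ω ∂(P x) := fun g => by
      rw [integral_withDensity_eq_integral_toReal_smul hZm.ennreal_ofReal
        (Eventually.of_forall fun _ => ENNReal.ofReal_lt_top)]
      simp [ENNReal.toReal_ofReal, h0]
    have key := congrArg (fun m => ∫ y, h y ∂m) (hV.map_withDensity x s t hZ h0 hB)
    beta_reduce at key
    rw [integral_map (hV.measurable _).aemeasurable hh.aestronglyMeasurable, hdens] at key
    rw [key]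
    have hmap : IsFiniteMeasure
        (((P x).withDensity fun ω => ENNReal.ofReal (Z ω)).map (V s)) := inferInstance
    have hmk : IsMarkovKernel (P.map (V t)) := Kernel.IsMarkovKernel.map P (hV.measurable t)
    obtain ⟨B', -, hB'⟩ := exists_norm_le hh
    rw [integral_bind_kernel (integrable_of_continuous_compactSpace hh _),
      integral_map (hV.measurable s).aemeasurable, hdens]
    · refine integral_congr_ae (Eventually.of_forall fun ω => ?_)
      beta_reduce
      rw [Kernel.map_apply _ (hV.measurable t),
        integral_map (hV.measurable t).aemeasurable hh.aestronglyMeasurable]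
      rfl
    · exact (hh.measurable.stronglyMeasurable.integral_kernel).aestronglyMeasurable
  -- A signed weight is the difference of the nonnegative weights `Z + B` and `B`.
  have hB0 : ∀ ω, 0 ≤ Z ω + B := fun ω => by linarith [neg_abs_le (Z ω), hB ω]
  have h1 := hnonneg (hZ.add_const B) hB0 (B := B + B)
    (fun ω => by linarith [le_abs_self (Z ω), hB ω])
  have h2 := hnonneg (Z := fun _ => B) measurable_const
    (fun ω => (abs_nonneg _).trans (hB ω)) (B := B) (fun _ => le_rfl)
  have hZm : Measurable Z := hZ.mono (𝓕.le s) le_rfl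
  obtain ⟨B', -, hB'⟩ := exists_norm_le hh
  have i1 := hV.integrable_comp hh (s + t) (P x)
  have i2 : Integrable (fun ω => transition P V h t (V s ω)) (P x) :=
    Integrable.of_bound
      ((hV.measurable_transition hh t).comp (hV.measurable s)).aestronglyMeasurable B'
      (Eventually.of_forall fun ω => hV.norm_transition_le hB' _ _)
  have hbd : ∀ᵐ ω ∂(P x), ‖Z ω‖ ≤ B := Eventually.of_forall hB
  simp only [add_mul] at h1
  rw [integral_add (i1.bdd_mul hZm.aestronglyMeasurable hbd) (i1.const_mul B),
    integral_add (i2.bdd_mul hZm.aestronglyMeasurable hbd) (i2.const_mul B), h2] at h1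
  exact add_right_cancel h1

end Transition

/-! ### Uniform unique ergodicity of the index process. -/

section Ergodic

variable {S : Type u} {Ω : Type v} [TopologicalSpace S] [PolishSpace S]
    [CompactSpace S] [MeasurableSpace S] [BorelSpace S] [mΩ : MeasurableSpace Ω]
    {𝓕 : Filtration ℝ≥0 mΩ} {P : Kernel S Ω} {V : ℝ≥0 → Ω → S}

theorem IsFellerProcess.continuous_transition (hV : IsFellerProcess 𝓕 P V) {h : S → ℝ}
    (hh : Continuous h) (t : ℝ≥0) : Continuous (transition P V h t) :=
  hV.feller t ⟨h, hh⟩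

/-- Chapman–Kolmogorov equation. -/
theorem IsFellerProcess.transition_transition (hV : IsFellerProcess 𝓕 P V) {h : S → ℝ}
    (hh : Continuous h) (s t : ℝ≥0) (x : S) :
    transition P V (transition P V h t) s x = transition P V h (s + t) x := by
  have := hV.integral_mul_comp x s t (Z := fun _ => 1) measurable_const (B := 1) (by simp) hh
  simpa [transition] using this.symm

theorem IsFellerProcess.intervalIntegrable_transition {E : Type*} [NormedAddCommGroup E]
    [NormedSpace ℝ E] [CompleteSpace E] [SecondCountableTopology E]
    (hV : IsFellerProcess 𝓕 P V) {h : S → E}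
    (hh : Continuous h) (x : S) (a b : ℝ) :
    IntervalIntegrable (fun u : ℝ => transition P V h u.toNNReal x) volume a b := by
  borelize E
  obtain ⟨B, -, hB⟩ := exists_norm_le hh
  have hm : Measurable fun u : ℝ => transition P V h u.toNNReal x :=
    (hV.measurable_uncurry_transition hh).comp (measurable_real_toNNReal.prodMk measurable_const)
  exact (intervalIntegrable_const (c := B)).mono_fun' hm.aestronglyMeasurable
    (Eventually.of_forall fun u => hV.norm_transition_le hB _ _)

/-- The expected occupation measure of the process on `[0, L]`, started in `x`. -/
def occupation (P : Kernel S Ω) (V : ℝ≥0 → Ω → S) (L : ℝ) (x : S) : Measure S :=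
  (((ENNReal.ofReal L)⁻¹ • volume.restrict (Set.Ioc 0 L)).prod (P x)).map
    fun p : ℝ × Ω => V p.1.toNNReal p.2

theorem IsFellerProcess.measurable_real_uncurry (hV : IsFellerProcess 𝓕 P V) :
    Measurable fun p : ℝ × Ω => V p.1.toNNReal p.2 :=
  hV.measurable_uncurry.comp ((measurable_real_toNNReal.comp measurable_fst).prodMk measurable_snd)

theorem isProbabilityMeasure_smul_restrict_Ioc {L : ℝ} (hL : 0 < L) :
    IsProbabilityMeasure ((ENNReal.ofReal L)⁻¹ • volume.restrict (Set.Ioc 0 L)) := by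
  constructor
  simp only [Measure.smul_apply, Measure.restrict_apply_univ, Real.volume_Ioc, sub_zero, smul_eq_mul]
  exact ENNReal.inv_mul_cancel (by simpa using hL) ENNReal.ofReal_ne_top

theorem IsFellerProcess.isProbabilityMeasure_occupation (hV : IsFellerProcess 𝓕 P V) {L : ℝ}
    (hL : 0 < L) (x : S) : IsProbabilityMeasure (occupation P V L x) := by
  have := hV.isProb
  have := isProbabilityMeasure_smul_restrict_Ioc hL
  exact Measure.isProbabilityMeasure_map hV.measurable_real_uncurry.aemeasurable

theorem IsFellerProcess.integral_occupation (hV : IsFellerProcess 𝓕 P V) {L : ℝ}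
    (hL : 0 < L) (x : S) {h : S → ℝ} (hh : Continuous h) :
    ∫ y, h y ∂(occupation P V L x) = L⁻¹ * ∫ u in (0 : ℝ)..L, transition P V h u.toNNReal x := by
  have := hV.isProb
  have := isProbabilityMeasure_smul_restrict_Ioc hL
  obtain ⟨B, -, hB⟩ := exists_norm_le hh
  rw [occupation, integral_map hV.measurable_real_uncurry.aemeasurable hh.aestronglyMeasurable,
    integral_prod, integral_smul_measure, intervalIntegral.integral_of_le hL.le]
  · simp [ENNReal.toReal_ofReal hL.le, transition]
  · exact Integrable.of_bound (hh.measurable.comp hV.measurable_real_uncurry).aestronglyMeasurable B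
      (Eventually.of_forall fun p => hB _)

/-- The occupation measures are almost invariant. -/
theorem IsFellerProcess.abs_integral_transition_occupation_sub_le (hV : IsFellerProcess 𝓕 P V)
    {L : ℝ} (hL : 0 < L) (x : S) {h : S → ℝ} (hh : Continuous h) {B : ℝ} (hB : ∀ y, ‖h y‖ ≤ B)
    (t : ℝ≥0) :
    |∫ y, transition P V h t y ∂(occupation P V L x) - ∫ y, h y ∂(occupation P V L x)| ≤
      2 * B * t / L := by
  rw [hV.integral_occupation hL x (hV.continuous_transition hh t), hV.integral_occupation hL x hh]
  have hint := fun a b => hV.intervalIntegrable_transition hh x a b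
  have h1 : ∫ u in (0 : ℝ)..L, transition P V (transition P V h t) u.toNNReal x =
      ∫ u in (t : ℝ)..(L + t), transition P V h u.toNNReal x := by
    have hshift := intervalIntegral.integral_comp_add_right (a := 0) (b := L)
      (fun u => transition P V h u.toNNReal x) (t : ℝ)
    rw [zero_add] at hshift
    rw [← hshift]
    refine intervalIntegral.integral_congr fun u hu => ?_
    rw [Set.uIcc_of_le hL.le] at hu
    rw [hV.transition_transition hh, Real.toNNReal_add hu.1 t.coe_nonneg, Real.toNNReal_coe]
  -- Shifting the window by `t` changes only two end pieces of length `t`, each contributing at most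
  -- `B * t`.
  have h2 : (∫ u in (t : ℝ)..(L + t), transition P V h u.toNNReal x) -
      ∫ u in (0 : ℝ)..L, transition P V h u.toNNReal x =
      (∫ u in L..(L + t), transition P V h u.toNNReal x) -
        ∫ u in (0 : ℝ)..t, transition P V h u.toNNReal x := by
    rw [← intervalIntegral.integral_add_adjacent_intervals (hint 0 t) (hint t L),
      ← intervalIntegral.integral_add_adjacent_intervals (hint t L) (hint L (L + t))]
    ring
  have hb : ∀ a b : ℝ, |∫ u in a..b, transition P V h u.toNNReal x| ≤ B * |b - a| := fun a b =>
    intervalIntegral.norm_integral_le_of_norm_le_const fun u _ => hV.norm_transition_le hB _ _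
  rw [h1, ← mul_sub, h2, abs_mul, abs_of_pos (inv_pos.2 hL), inv_mul_le_iff₀ hL,
    mul_div_cancel₀ _ hL.ne']
  have h3 := hb L (L + t)
  have h4 := hb 0 t
  rw [add_sub_cancel_left, abs_of_nonneg t.coe_nonneg] at h3
  rw [sub_zero, abs_of_nonneg t.coe_nonneg] at h4
  refine (abs_sub _ _).trans ?_
  linarith

/-- Unique ergodicity of a Feller process on a compact space: time averages of the transition
operators converge uniformly in the starting point. -/
theorem IsFellerProcess.exists_forall_abs_average_sub_lt (hV : IsFellerProcess 𝓕 P V)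
    {π : Measure S} (huniq : ∀ ν : Measure S, IsInvariantFor P V ν → ν = π) {h : S → ℝ}
    (hh : Continuous h) {ε : ℝ} (hε : 0 < ε) :
    ∃ L₀ > (0 : ℝ), ∀ L ≥ L₀, ∀ x,
      |L⁻¹ * (∫ u in (0 : ℝ)..L, transition P V h u.toNNReal x) - ∫ y, h y ∂π| < ε := by
  have := hV.isProb
  by_contra! hcon
  choose L hL x hx using fun n : ℕ => hcon (n + 1) (by positivity)
  have hL0 : ∀ n, 0 < L n := fun n => lt_of_lt_of_le (by positivity) (hL n)
  let m : ℕ → ProbabilityMeasure S := fun n =>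
    ⟨occupation P V (L n) (x n), hV.isProbabilityMeasure_occupation (hL0 n) (x n)⟩
  -- Probability measures on a compact space form a compact space, so the counterexample sequence of
  -- occupation measures has a limit along an ultrafilter, without extracting a subsequence.
  obtain ⟨ν, hν⟩ : ∃ ν, Tendsto m (hyperfilter ℕ : Filter ℕ) (𝓝 ν) :=
    ⟨_, ((hyperfilter ℕ).map m).le_nhds_lim⟩
  rw [ProbabilityMeasure.tendsto_iff_forall_integral_tendsto] at hν
  have hlim : ∀ {g : S → ℝ}, Continuous g →
      Tendsto (fun n => ∫ y, g y ∂(occupation P V (L n) (x n))) (hyperfilter ℕ : Filter ℕ)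
        (𝓝 (∫ y, g y ∂(ν : Measure S))) := fun {g} hg =>
    hν (BoundedContinuousFunction.mkOfCompact ⟨g, hg⟩)
  have hinv : IsInvariantFor P V (ν : Measure S) := by
    refine ⟨inferInstance, fun t => ?_⟩
    have : IsProbabilityMeasure (lawFrom P (ν : Measure S)) := by
      unfold lawFrom; infer_instance
    have : IsProbabilityMeasure ((lawFrom P (ν : Measure S)).map (V t)) :=
      Measure.isProbabilityMeasure_map (hV.measurable t).aemeasurable
    refine ext_of_forall_integral_eq_of_IsFiniteMeasure fun g => ?_
    have hg : Continuous g := g.continuous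
    obtain ⟨B, -, hB⟩ := exists_norm_le hg
    have h1 := hlim (hV.continuous_transition hg t)
    have h2 := hlim hg
    have h3 : Tendsto (fun n => ∫ y, transition P V g t y ∂(occupation P V (L n) (x n)) -
        ∫ y, g y ∂(occupation P V (L n) (x n))) (hyperfilter ℕ : Filter ℕ) (𝓝 0) := by
      have hLt : Tendsto L atTop atTop := tendsto_atTop_mono
        (fun n => (le_add_of_nonneg_right zero_le_one).trans (hL n)) tendsto_natCast_atTop_atTop
      refine (squeeze_zero_norm (fun n =>
        hV.abs_integral_transition_occupation_sub_le (hL0 n) (x n) hg hB t)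
        (hLt.const_div_atTop _)).mono_left ?_
      rw [← Nat.cofinite_eq_atTop]
      exact hyperfilter_le_cofinite
    -- The Feller property makes `transition P V g t` a continuous test function, so the vanishing
    -- invariance defect passes to the limit.
    have h4 := tendsto_nhds_unique (h1.sub h2) h3
    rw [integral_map (hV.measurable t).aemeasurable hg.aestronglyMeasurable]
    unfold lawFrom at *
    rw [integral_bind_kernel (hV.integrable_comp hg t _)]
    exact sub_eq_zero.1 h4
  have hfin := hlim hh
  rw [huniq _ hinv] at hfin
  have h5 := (hfin.sub_const (∫ y, h y ∂π)).abs
  rw [sub_self, abs_zero] at h5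
  obtain ⟨n, hn⟩ := (h5.eventually (gt_mem_nhds hε)).exists
  rw [hV.integral_occupation (hL0 n) (x n) hh] at hn
  exact (hx n).not_gt hn

theorem norm_le_sum_abs_apply {K : ℕ} (z : EuclideanSpace ℝ (Fin K)) : ‖z‖ ≤ ∑ i, |z i| := by
  rw [EuclideanSpace.norm_eq, Real.sqrt_le_left (Finset.sum_nonneg fun i _ => abs_nonneg _)]
  exact Finset.sum_sq_le_sq_sum_of_nonneg fun i _ => norm_nonneg (z i)

theorem IsFellerProcess.transition_apply (hV : IsFellerProcess 𝓕 P V) {K : ℕ}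
    {G : S → EuclideanSpace ℝ (Fin K)} (hG : Continuous G) (t : ℝ≥0) (x : S) (i : Fin K) :
    transition P V G t x i = transition P V (fun y => G y i) t x := by
  have := hV.isProb
  exact ((EuclideanSpace.proj (𝕜 := ℝ) i).integral_comp_comm
    (hV.integrable_comp hG t (P x))).symm

/-- The scalar ergodic theorem is applied to each coordinate with tolerance `ε / (K + 1)`. The extra
`1` in this denominator and in the window length covers `K = 0`. -/
theorem IsFellerProcess.exists_forall_norm_integral_transition_le (hV : IsFellerProcess 𝓕 P V)
    {π : Measure S} [IsFiniteMeasure π] (huniq : ∀ ν : Measure S, IsInvariantFor P V ν → ν = π)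
    {K : ℕ} {G : S → EuclideanSpace ℝ (Fin K)} (hG : Continuous G) (hG0 : ∫ y, G y ∂π = 0)
    {ε : ℝ} (hε : 0 < ε) :
    ∃ L₀ > (0 : ℝ), ∀ L ≥ L₀, ∀ x,
      L⁻¹ * ‖∫ u in (0 : ℝ)..L, transition P V G u.toNNReal x‖ ≤ ε := by
  have hGi : ∀ i, Continuous fun y => G y i := fun i =>
    (EuclideanSpace.proj (𝕜 := ℝ) i).continuous.comp hG
  choose L₀ hL₀ hL using fun i : Fin K => hV.exists_forall_abs_average_sub_lt huniq (hGi i)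
    (ε := ε / (K + 1)) (by positivity)
  refine ⟨1 + ∑ i, L₀ i, add_pos_of_pos_of_nonneg one_pos
    (Finset.sum_nonneg fun i _ => (hL₀ i).le), fun L hLL x => ?_⟩
  have hLi : ∀ i, L₀ i ≤ L := fun i =>
    (Finset.single_le_sum (fun j _ => (hL₀ j).le) (Finset.mem_univ i)).trans (by linarith)
  have hLpos : 0 < L := lt_of_lt_of_le (add_pos_of_pos_of_nonneg one_pos
    (Finset.sum_nonneg fun i _ => (hL₀ i).le)) hLL
  have hcoord : ∀ i, L⁻¹ * |(∫ u in (0 : ℝ)..L, transition P V G u.toNNReal x) i| ≤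
      ε / (K + 1) := by
    intro i
    have h1 : (∫ u in (0 : ℝ)..L, transition P V G u.toNNReal x) i =
        ∫ u in (0 : ℝ)..L, transition P V (fun y => G y i) u.toNNReal x := by
      have := (EuclideanSpace.proj (𝕜 := ℝ) i).intervalIntegral_comp_comm
        (hV.intervalIntegrable_transition hG x 0 L)
      exact this.symm.trans
        (intervalIntegral.integral_congr fun u _ => hV.transition_apply hG _ x i)
    have h2 : ∫ y, G y i ∂π = 0 := by
      have := (EuclideanSpace.proj (𝕜 := ℝ) i).integral_comp_comm
        (integrable_of_continuous_compactSpace hG π)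
      simpa [hG0] using this
    have h3 := (hL i L (hLi i) x).le
    rwa [h2, sub_zero, abs_mul, abs_of_pos (inv_pos.2 hLpos), ← h1] at h3
  calc _ ≤ L⁻¹ * ∑ i, |(∫ u in (0 : ℝ)..L, transition P V G u.toNNReal x) i| := by
        gcongr; exact norm_le_sum_abs_apply _
    _ ≤ ∑ _i : Fin K, ε / (K + 1) := by
        rw [Finset.mul_sum]; exact Finset.sum_le_sum fun i _ => hcoord i
    _ ≤ ε := by
        rw [Finset.sum_const, Finset.card_univ, Fintype.card_fin, nsmul_eq_mul, ← mul_div_assoc,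
          div_le_iff₀ (by positivity)]
        nlinarith

/-- A modulus for the uniform convergence of the time averages of a centred observable. -/
theorem IsFellerProcess.exists_averageModulus (hV : IsFellerProcess 𝓕 P V)
    {π : Measure S} [IsFiniteMeasure π] (huniq : ∀ ν : Measure S, IsInvariantFor P V ν → ν = π)
    {K : ℕ} {G : S → EuclideanSpace ℝ (Fin K)} (hG : Continuous G) (hG0 : ∫ y, G y ∂π = 0) :
    ∃ R : ℝ → ℝ, (∀ L, 0 ≤ R L) ∧ Tendsto R atTop (𝓝 0) ∧
      ∀ L' > 0, ∀ L ≥ L', ∀ x,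
        ‖∫ u in (0 : ℝ)..L, transition P V G u.toNNReal x‖ ≤ L * R L' := by
  obtain ⟨B, hB0, hB⟩ := exists_norm_le hG
  -- The modulus is the supremum of the normalised averages over all starting points and all windows
  -- of length at least `L'`.
  let A : ℝ → Set ℝ := fun L' => {r | ∃ L, 0 < L ∧ L' ≤ L ∧ ∃ x,
    r = L⁻¹ * ‖∫ u in (0 : ℝ)..L, transition P V G u.toNNReal x‖}
  have hA0 : ∀ L', ∀ r ∈ A L', 0 ≤ r := by
    rintro L' r ⟨L, hL, -, x, rfl⟩
    positivity
  have hAB : ∀ L', BddAbove (A L') := by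
    refine fun L' => ⟨B, ?_⟩
    rintro r ⟨L, hL, -, x, rfl⟩
    rw [inv_mul_le_iff₀ hL]
    refine (intervalIntegral.norm_integral_le_of_norm_le_const fun u _ =>
      hV.norm_transition_le hB _ _).trans ?_
    rw [sub_zero, abs_of_pos hL, mul_comm]
  refine ⟨fun L' => sSup (A L'), fun L' => Real.sSup_nonneg (hA0 L'), ?_, ?_⟩
  · rw [Metric.tendsto_atTop]
    intro ε hε
    obtain ⟨L₀, hL₀, hL⟩ := hV.exists_forall_norm_integral_transition_le huniq hG hG0
      (half_pos hε)
    refine ⟨L₀, fun L' hL' => ?_⟩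
    rw [Real.dist_0_eq_abs, abs_of_nonneg (Real.sSup_nonneg (hA0 L'))]
    refine lt_of_le_of_lt (Real.sSup_le ?_ (half_pos hε).le) (half_lt_self hε)
    rintro r ⟨L, -, hLL, x, rfl⟩
    exact hL L (hL'.trans hLL) x
  · intro L' hL' L hL x
    have hLpos : 0 < L := hL'.trans_le hL
    rw [← inv_mul_le_iff₀ hLpos]
    exact le_csSup (hAB L') ⟨L, hLpos, hL, x, rfl⟩

end Ergodic

/-! ### Strong convexity and the minimizer of the full target. -/

section Target

variable {S : Type u} [TopologicalSpace S] [MeasurableSpace S] {K : ℕ}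
    {f : EuclideanSpace ℝ (Fin K) → S → ℝ} {π : Measure S} {κ : ℝ}

theorem TargetAssumption.hasGradientAt (hf : TargetAssumption f π)
    (θ : EuclideanSpace ℝ (Fin K)) (y : S) :
    HasGradientAt (fun z => f z y) (gradθ f θ y) θ :=
  (((hf.contDiff y).differentiable (by norm_num)) θ).hasGradientAt

theorem TargetAssumption.continuous_grad (hf : TargetAssumption f π)
    (θ : EuclideanSpace ℝ (Fin K)) : Continuous (gradθ f θ) :=
  hf.cont_grad.comp (Continuous.prodMk_right θ)

/-- Along the segment from `z` to `x`, the function minus its linear part and the quadratic `κ/2 s²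
‖x - z‖²` has nonnegative derivative by strong monotonicity of the gradient. -/
theorem UniformlyStronglyConvex.le_apply (hconv : UniformlyStronglyConvex f κ)
    (hf : TargetAssumption f π) (x z : EuclideanSpace ℝ (Fin K)) (y : S) :
    f z y + inner ℝ (gradθ f z y) (x - z) + κ / 2 * ‖x - z‖ ^ 2 ≤ f x y := by
  let ψ : ℝ → ℝ := fun s => f (z + s • (x - z)) y - s * inner ℝ (gradθ f z y) (x - z) -
    κ / 2 * s ^ 2 * ‖x - z‖ ^ 2
  let ψ' : ℝ → ℝ := fun s => inner ℝ (gradθ f (z + s • (x - z)) y) (x - z) -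
    inner ℝ (gradθ f z y) (x - z) - κ * s * ‖x - z‖ ^ 2
  have hψ : ∀ s, HasDerivAt ψ (ψ' s) s := by
    intro s
    have h1 : HasDerivAt (fun s : ℝ => z + s • (x - z)) (x - z) s := by
      simpa using ((hasDerivAt_id s).smul_const (x - z)).const_add z
    have h2 := (hf.hasGradientAt (z + s • (x - z)) y).hasFDerivAt.comp_hasDerivAt s h1
    have h3 := (hasDerivAt_id s).mul_const (inner ℝ (gradθ f z y) (x - z))
    have h4 := (((hasDerivAt_id s).pow 2).const_mul (κ / 2)).mul_const (‖x - z‖ ^ 2)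
    convert! (h2.sub h3).sub h4 using 1
    simp [ψ']
    left
    ring
  have hmono : MonotoneOn ψ (Set.Icc 0 1) := by
    refine monotoneOn_of_deriv_nonneg (convex_Icc 0 1)
      (fun s _ => (hψ s).continuousAt.continuousWithinAt)
      (fun s _ => (hψ s).differentiableAt.differentiableWithinAt) fun s hs => ?_
    rw [interior_Icc] at hs
    rw [(hψ s).deriv]
    have h := hconv y (z + s • (x - z)) z
    rw [add_sub_cancel_left, norm_smul, real_inner_smul_left, Real.norm_of_nonneg hs.1.le,
      real_inner_comm, inner_sub_left] at h
    have h' : s * (κ * s * ‖x - z‖ ^ 2) ≤ s * (inner ℝ (gradθ f (z + s • (x - z)) y) (x - z) -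
      inner ℝ (gradθ f z y) (x - z)) := by linarith
    have := le_of_mul_le_mul_left h' hs.1
    simp only [ψ']
    linarith
  have := hmono (Set.left_mem_Icc.2 zero_le_one) (Set.right_mem_Icc.2 zero_le_one) zero_le_one
  simp [ψ] at this
  linarith

/-- The mean gradient vanishes somewhere. -/
theorem UniformlyStronglyConvex.exists_integral_grad_eq_zero [IsProbabilityMeasure π]
    (hconv : UniformlyStronglyConvex f κ) (hκ : 0 < κ) (hf : TargetAssumption f π) :
    ∃ θstar : EuclideanSpace ℝ (Fin K), ∫ y, gradθ f θstar y ∂π = 0 := by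
  obtain ⟨L, hL⟩ := hf.lipschitz
  let g : EuclideanSpace ℝ (Fin K) → EuclideanSpace ℝ (Fin K) := fun θ => ∫ y, gradθ f θ y ∂π
  have hsub : ∀ x z, g x - g z = ∫ y, (gradθ f x y - gradθ f z y) ∂π := fun x z =>
    (integral_sub (hf.integrable_grad x) (hf.integrable_grad z)).symm
  -- Adding `κ` to the Lipschitz constant ensures `M > 0` and `κ ≤ M`.
  let M : ℝ := L + κ
  have hM : 0 < M := add_pos_of_nonneg_of_pos L.2 hκ
  have hκM : κ ≤ M := le_add_of_nonneg_left L.2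
  have hlip : ∀ x z, ‖g x - g z‖ ≤ M * ‖x - z‖ := by
    intro x z
    rw [hsub]
    have h1 := norm_integral_le_of_norm_le_const (μ := π) (f := fun y => gradθ f x y - gradθ f z y)
      (C := L * ‖x - z‖) (Eventually.of_forall fun y => (hL y).norm_sub_le x z)
    rw [probReal_univ, mul_one] at h1
    refine h1.trans ?_
    gcongr
    exact le_add_of_nonneg_right hκ.le
  have hmon : ∀ x z, κ * ‖x - z‖ ^ 2 ≤ inner ℝ (x - z) (g x - g z) := by
    intro x z
    have hd : Integrable (fun y => gradθ f x y - gradθ f z y) π :=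
      (hf.integrable_grad x).sub (hf.integrable_grad z)
    rw [hsub, ← integral_inner hd]
    have h1 : ∫ _y, κ * ‖x - z‖ ^ 2 ∂π ≤
        ∫ y, inner ℝ (x - z) (gradθ f x y - gradθ f z y) ∂π :=
      integral_mono (integrable_const _)
        (hd.const_inner _) fun y => hconv y x z
    simpa using h1
  -- A gradient step of length `s` multiplies squared distances by at most `1 - 2sκ + s²M²`; this
  -- `s` minimises that factor, with value `1 - κ²/M²`. Banach's fixed point theorem then provides
  -- the zero.
  let s : ℝ := κ / M ^ 2
  let q : ℝ≥0 := (Real.sqrt (1 - κ ^ 2 / M ^ 2)).toNNReal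
  have hc : ContractingWith q fun θ => θ - s • g θ := by
    constructor
    · have : Real.sqrt (1 - κ ^ 2 / M ^ 2) < 1 := by
        rw [Real.sqrt_lt' one_pos]
        have : 0 < κ ^ 2 / M ^ 2 := by positivity
        linarith
      rw [← NNReal.coe_lt_coe, Real.coe_toNNReal _ (Real.sqrt_nonneg _)]
      simpa using this
    · refine LipschitzWith.of_dist_le_mul fun x z => ?_
      rw [Real.coe_toNNReal _ (Real.sqrt_nonneg _), dist_eq_norm, dist_eq_norm]
      have h1 : x - s • g x - (z - s • g z) = (x - z) - s • (g x - g z) := by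
        rw [smul_sub]; abel
      refine le_of_sq_le_sq ?_ (by positivity)
      have hq : 0 ≤ 1 - κ ^ 2 / M ^ 2 := by
        rw [sub_nonneg, div_le_one (by positivity)]
        gcongr
      rw [mul_pow, Real.sq_sqrt hq, h1, norm_sub_sq_real, real_inner_smul_right, norm_smul,
        mul_pow, Real.norm_eq_abs, sq_abs]
      have h2 : ‖g x - g z‖ ^ 2 ≤ M ^ 2 * ‖x - z‖ ^ 2 := by
        rw [← mul_pow]
        gcongr
        exact hlip x z
      have h3 := hmon x z
      have hs : 0 < s := by positivity
      have h4 : s ^ 2 * ‖g x - g z‖ ^ 2 ≤ s ^ 2 * (M ^ 2 * ‖x - z‖ ^ 2) := by gcongr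
      have h5 : s * (κ * ‖x - z‖ ^ 2) ≤ s * inner ℝ (x - z) (g x - g z) := by gcongr
      have h6 : s ^ 2 * (M ^ 2 * ‖x - z‖ ^ 2) = κ ^ 2 / M ^ 2 * ‖x - z‖ ^ 2 := by
        simp only [s]; field_simp
      have h7 : s * (κ * ‖x - z‖ ^ 2) = κ ^ 2 / M ^ 2 * ‖x - z‖ ^ 2 := by
        simp only [s]; field_simp
      linarith
  refine ⟨hc.fixedPoint, ?_⟩
  have h := hc.fixedPoint_isFixedPt
  have h1 : s • g hc.fixedPoint = 0 := by
    simpa [Function.IsFixedPt] using h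
  have hs : s ≠ 0 := by positivity
  exact (smul_eq_zero.1 h1).resolve_left hs

/-- On integrating the pointwise quadratic lower bound at `θstar`, the linear term vanishes because
the mean gradient does. -/
theorem UniformlyStronglyConvex.fullTarget_add_le [IsProbabilityMeasure π]
    (hconv : UniformlyStronglyConvex f κ) (hf : TargetAssumption f π)
    {θstar : EuclideanSpace ℝ (Fin K)} (h0 : ∫ y, gradθ f θstar y ∂π = 0)
    (θ : EuclideanSpace ℝ (Fin K)) :
    fullTarget f π θstar + κ / 2 * ‖θ - θstar‖ ^ 2 ≤ fullTarget f π θ := by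
  have hi : Integrable (fun y => inner ℝ (gradθ f θstar y) (θ - θstar)) π :=
    (hf.integrable_grad θstar).inner_const _
  have hi' : Integrable (fun y => f θstar y + inner ℝ (gradθ f θstar y) (θ - θstar)) π :=
    (hf.integrable θstar).add hi
  have h1 : ∫ y, (f θstar y + inner ℝ (gradθ f θstar y) (θ - θstar) +
      κ / 2 * ‖θ - θstar‖ ^ 2) ∂π ≤ ∫ y, f θ y ∂π :=
    integral_mono (hi'.add (integrable_const _)) (hf.integrable θ)
      (fun y => hconv.le_apply hf θ θstar y)
  rw [integral_add hi' (integrable_const _),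
    integral_add (hf.integrable θstar) hi] at h1
  have h2 : ∫ y, inner ℝ (gradθ f θstar y) (θ - θstar) ∂π = 0 := by
    have := integral_inner (𝕜 := ℝ) (hf.integrable_grad θstar) (θ - θstar)
    simp only [real_inner_comm (θ - θstar)]
    rw [this, h0, inner_zero_right]
  rw [h2] at h1
  simpa [fullTarget] using h1

end Target

/-! ### Pathwise energy estimates. -/

/-- `x` solves `x' = -∇_θ f(x, v)`, `x_0 = θ₀`, in integrated form, where the driving path `v` is
right-continuous. -/
structure IsGradientPath {S : Type*} [TopologicalSpace S] {K : ℕ}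
    (f : EuclideanSpace ℝ (Fin K) → S → ℝ) (v : ℝ≥0 → S) (θ₀ : EuclideanSpace ℝ (Fin K))
    (x : ℝ≥0 → EuclideanSpace ℝ (Fin K)) : Prop where
  rightCont : ∀ t, ContinuousWithinAt v (Set.Ici t) t
  cont : Continuous x
  eqn : ∀ t : ℝ≥0, x t = θ₀ - ∫ s in (0 : ℝ)..t, gradθ f (x s.toNNReal) (v s.toNNReal)

theorem continuousWithinAt_comp_toNNReal {E : Type*} [TopologicalSpace E] {φ : ℝ≥0 → E}
    (hφ : ∀ t, ContinuousWithinAt φ (Set.Ici t) t) (s : ℝ) :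
    ContinuousWithinAt (fun r : ℝ => φ r.toNNReal) (Set.Ici s) s :=
  (hφ s.toNNReal).comp continuous_real_toNNReal.continuousWithinAt
    fun _ hr => Real.toNNReal_mono hr

theorem measurable_comp_toNNReal {E : Type*} [TopologicalSpace E]
    [TopologicalSpace.PseudoMetrizableSpace E] [MeasurableSpace E] [BorelSpace E] {φ : ℝ≥0 → E}
    (hφ : ∀ t, ContinuousWithinAt φ (Set.Ici t) t) :
    Measurable fun r : ℝ => φ r.toNNReal := by
  have h1 := measurable_uncurry_of_rightCont (α := Unit) (X := fun t _ => φ t)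
    (fun t => measurable_const) (fun _ t => hφ t)
  exact h1.comp (measurable_real_toNNReal.prodMk (measurable_const (a := ())))

section Path

variable {S : Type u} [TopologicalSpace S] [CompactSpace S] [MeasurableSpace S] {K : ℕ}
    {f : EuclideanSpace ℝ (Fin K) → S → ℝ} {π : Measure S} {κ : ℝ}
    {v : ℝ≥0 → S} {θ₀ : EuclideanSpace ℝ (Fin K)} {x : ℝ≥0 → EuclideanSpace ℝ (Fin K)}

theorem IsGradientPath.rightCont_grad (hx : IsGradientPath f v θ₀ x) (hf : TargetAssumption f π)
    (t : ℝ≥0) : ContinuousWithinAt (fun s => gradθ f (x s) (v s)) (Set.Ici t) t :=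
  hf.cont_grad.continuousAt.comp_continuousWithinAt
    (hx.cont.continuousWithinAt.prodMk (hx.rightCont t))

theorem TargetAssumption.exists_norm_grad_le (hf : TargetAssumption f π)
    {A : Set (EuclideanSpace ℝ (Fin K))} (hA : IsCompact A) :
    ∃ M, 0 ≤ M ∧ ∀ θ ∈ A, ∀ y, ‖gradθ f θ y‖ ≤ M := by
  obtain ⟨M, hM⟩ := ((hA.prod (isCompact_univ (X := S))).image hf.cont_grad.norm).bddAbove
  refine ⟨max M 0, le_max_right _ _, fun θ hθ y => le_max_of_le_left ?_⟩
  exact hM ⟨(θ, y), ⟨hθ, trivial⟩, rfl⟩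

theorem IsGradientPath.intervalIntegrable (hx : IsGradientPath f v θ₀ x)
    (hf : TargetAssumption f π) (a b : ℝ) :
    IntervalIntegrable (fun s : ℝ => gradθ f (x s.toNNReal) (v s.toNNReal)) volume a b := by
  have hX : Continuous fun s : ℝ => x s.toNNReal := hx.cont.comp continuous_real_toNNReal
  obtain ⟨M, -, hM⟩ := hf.exists_norm_grad_le ((isCompact_uIcc (a := a) (b := b)).image hX)
  refine (intervalIntegrable_const (c := M)).mono_fun'
    (measurable_comp_toNNReal (hx.rightCont_grad hf)).aestronglyMeasurable ?_
  refine (ae_restrict_iff' measurableSet_uIoc).2 (Eventually.of_forall fun s hs => ?_)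
  exact hM _ ⟨s, Set.uIoc_subset_uIcc hs, rfl⟩ _

/-- The driving path may jump, so only a right derivative exists; the comparison arguments below use
versions of the mean value theorem that need no more. -/
theorem IsGradientPath.hasDerivWithinAt (hx : IsGradientPath f v θ₀ x)
    (hf : TargetAssumption f π) {s : ℝ} (hs : 0 ≤ s) :
    HasDerivWithinAt (fun r : ℝ => x r.toNNReal) (-gradθ f (x s.toNNReal) (v s.toNNReal))
      (Set.Ici s) s := by
  have hφ := hx.rightCont_grad hf
  have h1 : HasDerivWithinAt
      (fun r : ℝ => ∫ u in (0 : ℝ)..r, gradθ f (x u.toNNReal) (v u.toNNReal))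
      (gradθ f (x s.toNNReal) (v s.toNNReal)) (Set.Ici s) s :=
    intervalIntegral.integral_hasDerivWithinAt_right (hx.intervalIntegrable hf 0 s)
      (measurable_comp_toNNReal hφ).stronglyMeasurable.stronglyMeasurableAtFilter
      ((continuousWithinAt_comp_toNNReal hφ s).mono Set.Ioi_subset_Ici_self)
  refine (h1.const_sub θ₀).congr (fun r hr => ?_) ?_
  · rw [hx.eqn, Real.coe_toNNReal r (hs.trans hr)]
  · rw [hx.eqn, Real.coe_toNNReal s hs]

theorem IsGradientPath.hasDerivWithinAt_norm_sq (hx : IsGradientPath f v θ₀ x)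
    (hf : TargetAssumption f π) (θstar : EuclideanSpace ℝ (Fin K)) {s : ℝ} (hs : 0 ≤ s) :
    HasDerivWithinAt (fun r : ℝ => ‖x r.toNNReal - θstar‖ ^ 2)
      (-2 * inner ℝ (x s.toNNReal - θstar) (gradθ f (x s.toNNReal) (v s.toNNReal)))
      (Set.Ici s) s := by
  convert! ((hx.hasDerivWithinAt hf hs).sub_const θstar).norm_sq using 1
  rw [inner_neg_right]
  ring

theorem IsGradientPath.continuous_norm_sq (hx : IsGradientPath f v θ₀ x)
    (θstar : EuclideanSpace ℝ (Fin K)) : Continuous fun r : ℝ => ‖x r.toNNReal - θstar‖ ^ 2 :=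
  (((hx.cont.comp continuous_real_toNNReal).sub continuous_const).norm).pow 2

/-- The gradient at the moving point is replaced by the gradient at the fixed point `θstar`, the
only place where averaging is then needed. -/
theorem UniformlyStronglyConvex.neg_inner_le (hconv : UniformlyStronglyConvex f κ)
    (θ θstar : EuclideanSpace ℝ (Fin K)) (y : S) :
    -2 * inner ℝ (θ - θstar) (gradθ f θ y) ≤
      -2 * κ * ‖θ - θstar‖ ^ 2 - 2 * inner ℝ (θ - θstar) (gradθ f θstar y) := by
  have := hconv y θ θstar
  rw [inner_sub_right] at this
  linarith

/-- Gradient paths enter exponentially fast a ball that does not depend on the starting point. -/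
theorem IsGradientPath.norm_sq_le (hx : IsGradientPath f v θ₀ x)
    (hf : TargetAssumption f π) (hκ : 0 < κ) (hconv : UniformlyStronglyConvex f κ)
    {θstar : EuclideanSpace ℝ (Fin K)} {B : ℝ} (hB : ∀ y, ‖gradθ f θstar y‖ ≤ B) (t : ℝ≥0) :
    ‖x t - θstar‖ ^ 2 ≤ Real.exp (-κ * t) * ‖θ₀ - θstar‖ ^ 2 + B ^ 2 / κ ^ 2 := by
  let c : ℝ := B ^ 2 / κ ^ 2
  let F : ℝ → ℝ := fun r => Real.exp (κ * r) * (‖x r.toNNReal - θstar‖ ^ 2 - c)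
  let F' : ℝ → ℝ := fun s => Real.exp (κ * s) * κ * (‖x s.toNNReal - θstar‖ ^ 2 - c) +
    Real.exp (κ * s) *
      (-2 * inner ℝ (x s.toNNReal - θstar) (gradθ f (x s.toNNReal) (v s.toNNReal)))
  have hF : ∀ s, 0 ≤ s → HasDerivWithinAt F (F' s) (Set.Ici s) s := by
    intro s hs
    have h1 : HasDerivAt (fun r => Real.exp (κ * r)) (Real.exp (κ * s) * κ) s := by
      simpa using ((hasDerivAt_id s).const_mul κ).exp
    exact h1.hasDerivWithinAt.mul ((hx.hasDerivWithinAt_norm_sq hf θstar hs).sub_const c)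
  have hF' : ∀ s, F' s ≤ 0 := by
    intro s
    have h1 := hconv.neg_inner_le (x s.toNNReal) θstar (v s.toNNReal)
    have h2 : -(‖x s.toNNReal - θstar‖ * B) ≤
        inner ℝ (x s.toNNReal - θstar) (gradθ f θstar (v s.toNNReal)) := by
      refine neg_le_of_abs_le ((abs_real_inner_le_norm _ _).trans ?_)
      gcongr
      exact hB _
    -- Young's inequality spends half of the dissipation `2κ` on the forcing; the other half leaves
    -- the decay rate `κ`.
    have h3 : 2 * ‖x s.toNNReal - θstar‖ * B ≤ κ * ‖x s.toNNReal - θstar‖ ^ 2 + κ * c := by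
      have h4 : κ * c = B ^ 2 / κ := by simp only [c]; field_simp
      rw [h4, ← sub_nonneg]
      have h5 : κ * ‖x s.toNNReal - θstar‖ ^ 2 + B ^ 2 / κ - 2 * ‖x s.toNNReal - θstar‖ * B =
        (κ * ‖x s.toNNReal - θstar‖ - B) ^ 2 / κ := by field_simp; ring
      rw [h5]
      positivity
    have h6 : F' s = Real.exp (κ * s) * (κ * (‖x s.toNNReal - θstar‖ ^ 2 - c) +
        (-2 * inner ℝ (x s.toNNReal - θstar) (gradθ f (x s.toNNReal) (v s.toNNReal)))) := by
      simp only [F']; ring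
    rw [h6]
    refine mul_nonpos_of_nonneg_of_nonpos (Real.exp_pos _).le ?_
    linarith
  have h := image_le_of_deriv_right_le_deriv_boundary (f := F) (f' := F') (a := 0) (b := t)
    (B := fun _ => F 0) (B' := fun _ => 0)
    ((Real.continuous_exp.comp (continuous_const.mul continuous_id)).mul
      ((hx.continuous_norm_sq θstar).sub continuous_const)).continuousOn
    (fun s hs => hF s hs.1) le_rfl continuousOn_const
    (fun s _ => hasDerivWithinAt_const _ _ _) (fun s _ => hF' s)
    (Set.right_mem_Icc.2 t.coe_nonneg)
  have hx0 : x 0 = θ₀ := by simpa using hx.eqn 0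
  simp only [F, mul_zero, Real.exp_zero, Real.toNNReal_zero, hx0, Real.toNNReal_coe, one_mul] at h
  have h7 : ‖x t - θstar‖ ^ 2 - c ≤ Real.exp (-κ * t) * (‖θ₀ - θstar‖ ^ 2 - c) := by
    rw [neg_mul, Real.exp_neg, ← div_eq_inv_mul, le_div_iff₀ (Real.exp_pos _), mul_comm]
    exact h
  have hc : 0 ≤ Real.exp (-κ * t) * c := by positivity
  change _ ≤ _ + c
  linarith

/-- One step of the energy estimate. -/
theorem IsGradientPath.norm_sq_step_le (hx : IsGradientPath f v θ₀ x)
    (hf : TargetAssumption f π) (hκ : 0 < κ) (hconv : UniformlyStronglyConvex f κ)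
    {θstar : EuclideanSpace ℝ (Fin K)} {B R M : ℝ} (hB : ∀ y, ‖gradθ f θstar y‖ ≤ B) {s h : ℝ}
    (hs : 0 ≤ s) (hh : 0 ≤ h) (hR : ∀ r, s ≤ r → ‖x r.toNNReal - θstar‖ ≤ R)
    (hM : ∀ r, s ≤ r → ∀ y, ‖gradθ f (x r.toNNReal) y‖ ≤ M) :
    ‖x (s + h).toNNReal - θstar‖ ^ 2 ≤ (1 - 2 * κ * h) * ‖x s.toNNReal - θstar‖ ^ 2 +
      (4 * κ * R * M + 2 * M * B) * h ^ 2 -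
      2 * inner ℝ (x s.toNNReal - θstar)
        (∫ r in s..(s + h), gradθ f θstar (v r.toNNReal)) := by
  have hG := hf.continuous_grad θstar
  have hGm := measurable_comp_toNNReal (φ := fun t => gradθ f θstar (v t))
    fun t => hG.continuousAt.comp_continuousWithinAt (hx.rightCont t)
  have hGi : IntervalIntegrable (fun r : ℝ => gradθ f θstar (v r.toNNReal)) volume s (s + h) :=
    (intervalIntegrable_const (c := B)).mono_fun' hGm.aestronglyMeasurable
      (Eventually.of_forall fun r => hB _)
  have hR0 : 0 ≤ R := (norm_nonneg _).trans (hR s le_rfl)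
  let η : EuclideanSpace ℝ (Fin K) := x s.toNNReal - θstar
  -- The path has speed at most `M`, so it moves by at most `M * h` within the block.
  have hclose : ∀ r ∈ Set.Ioo s (s + h), ‖(x r.toNNReal - θstar) - η‖ ≤ M * h := by
    intro r hr
    have h1 := intervalIntegral.integral_eq_sub_of_hasDeriv_right_of_le hr.1.le
      (hx.cont.comp continuous_real_toNNReal).continuousOn
      (fun u hu => (hx.hasDerivWithinAt hf (hs.trans hu.1.le)).mono Set.Ioi_subset_Ici_self)
      (hx.intervalIntegrable hf s r).neg
    have hM0 : 0 ≤ M := (norm_nonneg _).trans (hM s le_rfl (v 0))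
    rw [sub_sub_sub_cancel_right]
    change ‖((fun t : ℝ => x t.toNNReal) r) - (fun t : ℝ => x t.toNNReal) s‖ ≤ _
    have h2 := intervalIntegral.norm_integral_le_of_norm_le_const (a := s) (b := r) (C := M)
      (f := fun s : ℝ => -gradθ f (x s.toNNReal) (v s.toNNReal)) (fun u hu => by
        rw [Set.uIoc_of_le hr.1.le] at hu
        rw [norm_neg]
        exact hM u hu.1.le _)
    rw [abs_of_nonneg (sub_nonneg.2 hr.1.le)] at h2
    have h3 : M * (r - s) ≤ M * h := mul_le_mul_of_nonneg_left (by linarith [hr.2]) hM0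
    refine le_trans (le_of_eq ?_) (h2.trans h3)
    exact congrArg norm h1.symm
  have hinner : IntervalIntegrable
      (fun r : ℝ => inner ℝ η (gradθ f θstar (v r.toNNReal))) volume s (s + h) :=
    ⟨hGi.1.const_inner η, hGi.2.const_inner η⟩
  have hint : ∫ r in s..(s + h), inner ℝ η (gradθ f θstar (v r.toNNReal)) =
      inner ℝ η (∫ r in s..(s + h), gradθ f θstar (v r.toNNReal)) :=
    (innerSL ℝ η).intervalIntegral_comp_comm hGi
  -- Freezing the position at `η` costs `2κ · 2R · Mh` in the squared norm and `2 · Mh · B` in the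
  -- inner product.
  let φ : ℝ → ℝ := fun r => (-2 * κ * ‖η‖ ^ 2 + (4 * κ * R * M + 2 * M * B) * h) -
    2 * inner ℝ η (gradθ f θstar (v r.toNNReal))
  have hφi : IntervalIntegrable φ volume s (s + h) :=
    intervalIntegrable_const.sub (hinner.const_mul 2)
  have key := intervalIntegral.sub_le_integral_of_hasDeriv_right_of_le (a := s) (b := s + h)
    (φ := φ) (le_add_of_nonneg_right hh) (hx.continuous_norm_sq θstar).continuousOn
    (fun r hr => (hx.hasDerivWithinAt_norm_sq hf θstar (hs.trans hr.1.le)).mono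
      Set.Ioi_subset_Ici_self)
    ((intervalIntegrable_iff_integrableOn_Icc_of_le (le_add_of_nonneg_right hh)).1 hφi) ?_
  · have h1 : ∫ r in s..(s + h), φ r =
        h * (-2 * κ * ‖η‖ ^ 2 + (4 * κ * R * M + 2 * M * B) * h) -
          2 * inner ℝ η (∫ r in s..(s + h), gradθ f θstar (v r.toNNReal)) := by
      rw [intervalIntegral.integral_sub intervalIntegrable_const (hinner.const_mul 2),
        intervalIntegral.integral_const, intervalIntegral.integral_const_mul, hint,
        add_sub_cancel_left, smul_eq_mul]
    rw [h1] at key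
    change _ ≤ (1 - 2 * κ * h) * ‖η‖ ^ 2 + _ - 2 * inner ℝ η _
    have key' : ‖x (s + h).toNNReal - θstar‖ ^ 2 - ‖η‖ ^ 2 ≤ _ := key
    linarith
  · intro r hr
    have hM0 : 0 ≤ M := (norm_nonneg _).trans (hM s le_rfl (v 0))
    have h1 := hconv.neg_inner_le (x r.toNNReal) θstar (v r.toNNReal)
    have h2 := hclose r hr
    let ζ : EuclideanSpace ℝ (Fin K) := x r.toNNReal - θstar
    have h3 : |inner ℝ (ζ - η) (gradθ f θstar (v r.toNNReal))| ≤ M * h * B :=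
      (abs_real_inner_le_norm _ _).trans
        (mul_le_mul h2 (hB _) (norm_nonneg _) (by positivity))
    rw [inner_sub_left] at h3
    have h4 : ‖η‖ ^ 2 - ‖ζ‖ ^ 2 ≤ 2 * R * (M * h) := by
      have h5 : ‖η‖ - ‖ζ‖ ≤ M * h := by
        refine (norm_sub_norm_le η ζ).trans ?_
        rw [norm_sub_rev]
        exact h2
      have h6 : ‖η‖ + ‖ζ‖ ≤ 2 * R := by
        linarith [hR s le_rfl, hR r hr.1.le]
      have h7 : ‖η‖ ^ 2 - ‖ζ‖ ^ 2 = (‖η‖ + ‖ζ‖) * (‖η‖ - ‖ζ‖) := by ring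
      rw [h7]
      calc _ ≤ (‖η‖ + ‖ζ‖) * (M * h) := by gcongr
        _ ≤ _ := by gcongr
    have h8 := (abs_le.1 h3).1
    have h9 : κ * (‖η‖ ^ 2 - ‖ζ‖ ^ 2) ≤ κ * (2 * R * (M * h)) := by gcongr
    change -2 * inner ℝ ζ _ ≤ -2 * κ * ‖η‖ ^ 2 + (4 * κ * R * M + 2 * M * B) * h - _
    change -2 * inner ℝ ζ _ ≤ -2 * κ * ‖ζ‖ ^ 2 - 2 * inner ℝ ζ _ at h1
    linarith

end Path

/-! ### Time changes with a non-decreasing rate. -/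

/-- `τ` is the time change `t ↦ ∫₀ᵗ m(s) ds` with a positive, continuous, non-decreasing rate. -/
structure IsTimeChange (τ : ℝ≥0 → ℝ≥0) (m : ℝ → ℝ) : Prop where
  cont : Continuous m
  pos : ∀ r, 0 < m r
  mono : Monotone m
  coe_eq : ∀ t : ℝ≥0, (τ t : ℝ) = ∫ r in (0 : ℝ)..t, m r

namespace IsTimeChange

variable {τ : ℝ≥0 → ℝ≥0} {m : ℝ → ℝ}

theorem hasDerivAt (hτ : IsTimeChange τ m) (r : ℝ) :
    HasDerivAt (fun r => ∫ u in (0 : ℝ)..r, m u) (m r) r :=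
  hτ.cont.integral_hasStrictDerivAt 0 r |>.hasDerivAt

theorem integral_sub (hτ : IsTimeChange τ m) (s r : ℝ) :
    (∫ u in (0 : ℝ)..r, m u) - ∫ u in (0 : ℝ)..s, m u = ∫ u in s..r, m u :=
  intervalIntegral.integral_interval_sub_left (hτ.cont.intervalIntegrable _ _)
    (hτ.cont.intervalIntegrable _ _)

theorem mul_le_integral (hτ : IsTimeChange τ m) {s r : ℝ} (h : s ≤ r) :
    m s * (r - s) ≤ ∫ u in s..r, m u := by
  have := intervalIntegral.integral_mono_on (μ := volume) h (intervalIntegrable_const (c := m s))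
    (hτ.cont.intervalIntegrable s r) fun u hu => hτ.mono hu.1
  simpa [mul_comm] using this

theorem integral_le_mul (hτ : IsTimeChange τ m) {s r : ℝ} (h : s ≤ r) :
    ∫ u in s..r, m u ≤ m r * (r - s) := by
  have := intervalIntegral.integral_mono_on (μ := volume) h (hτ.cont.intervalIntegrable s r)
    (intervalIntegrable_const (c := m r)) fun u hu => hτ.mono hu.2
  simpa [mul_comm] using this

theorem monotone_integral (hτ : IsTimeChange τ m) : Monotone fun r => ∫ u in (0 : ℝ)..r, m u := by
  intro s r h
  have h1 := hτ.mul_le_integral h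
  rw [← hτ.integral_sub] at h1
  have h2 : 0 ≤ m s * (r - s) := mul_nonneg (hτ.pos s).le (sub_nonneg.2 h)
  linarith

theorem monotone (hτ : IsTimeChange τ m) : Monotone τ := by
  intro s t h
  rw [← NNReal.coe_le_coe, hτ.coe_eq, hτ.coe_eq]
  exact hτ.monotone_integral (NNReal.coe_le_coe.2 h)

theorem continuous (hτ : IsTimeChange τ m) : Continuous τ := by
  rw [NNReal.isEmbedding_coe.continuous_iff]
  simp only [Function.comp_def, hτ.coe_eq]
  exact (continuous_iff_continuousAt.2 fun r => (hτ.hasDerivAt r).continuousAt).comp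
    NNReal.continuous_coe

theorem apply_eq_add (hτ : IsTimeChange τ m) {s r : ℝ} (hs : 0 ≤ s) (h : s ≤ r) :
    τ r.toNNReal = τ s.toNNReal +
      ((∫ u in (0 : ℝ)..r, m u) - ∫ u in (0 : ℝ)..s, m u).toNNReal := by
  rw [← NNReal.coe_inj, NNReal.coe_add, hτ.coe_eq, hτ.coe_eq, Real.coe_toNNReal r (hs.trans h),
    Real.coe_toNNReal s hs, Real.coe_toNNReal _ (sub_nonneg.2 (hτ.monotone_integral h))]
  ring

end IsTimeChange

/-! ### Averaging the centred gradient over a block. -/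

section Expectation

variable {S : Type u} {Ω : Type v} [TopologicalSpace S] [PolishSpace S]
    [CompactSpace S] [MeasurableSpace S] [BorelSpace S] [mΩ : MeasurableSpace Ω]
    {𝓕 : Filtration ℝ≥0 mΩ} {P : Kernel S Ω} {V : ℝ≥0 → Ω → S} {K : ℕ}
    {τ : ℝ≥0 → ℝ≥0} {m : ℝ → ℝ}

theorem IsGradientProcess.isGradientPath {f : EuclideanSpace ℝ (Fin K) → S → ℝ}
    {θ₀ : EuclideanSpace ℝ (Fin K)} {ξ : ℝ≥0 → Ω → EuclideanSpace ℝ (Fin K)}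
    (hξ : IsGradientProcess 𝓕 V f τ θ₀ ξ) (hV : IsFellerProcess 𝓕 P V) (hτ : IsTimeChange τ m)
    (ω : Ω) : IsGradientPath f (fun t => V (τ t) ω) θ₀ (fun t => ξ t ω) where
  rightCont t := (hV.cadlag ω (τ t)).1.comp hτ.continuous.continuousWithinAt
    fun _ hr => hτ.monotone hr
  cont := hξ.cont ω
  eqn := hξ.eqn ω

/-- Markov property in integrated form, for vector-valued functions. -/
theorem IsFellerProcess.integral_inner_comp (hV : IsFellerProcess 𝓕 P V) (x : S) (s t : ℝ≥0)
    {Z : Ω → EuclideanSpace ℝ (Fin K)} (hZ : Measurable[𝓕 s] Z) {B : ℝ} (hB : ∀ ω, ‖Z ω‖ ≤ B)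
    {G : S → EuclideanSpace ℝ (Fin K)} (hG : Continuous G) :
    ∫ ω, inner ℝ (Z ω) (G (V (s + t) ω)) ∂(P x) =
      ∫ ω, inner ℝ (Z ω) (transition P V G t (V s ω)) ∂(P x) := by
  have := hV.isProb
  obtain ⟨B', -, hB'⟩ := exists_norm_le hG
  have hproj : ∀ i, Continuous fun z : EuclideanSpace ℝ (Fin K) => z i := fun i =>
    (EuclideanSpace.proj (𝕜 := ℝ) i).continuous
  have hGi : ∀ i, Continuous fun y => G y i := fun i => (hproj i).comp hG
  have hZi : ∀ i, Measurable[𝓕 s] fun ω => Z ω i := fun i => (hproj i).measurable.comp hZ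
  have hZb : ∀ i ω, |Z ω i| ≤ B := fun i ω => (PiLp.norm_apply_le (Z ω) i).trans (hB ω)
  have hZm : ∀ i, AEStronglyMeasurable (fun ω => Z ω i) (P x) := fun i =>
    ((hZi i).mono (𝓕.le s) le_rfl).aestronglyMeasurable
  simp only [PiLp.inner_apply, RCLike.inner_apply, conj_trivial, mul_comm _ (Z _ _)]
  rw [integral_finsetSum, integral_finsetSum]
  · refine Finset.sum_congr rfl fun i _ => ?_
    simp only [hV.transition_apply hG]
    exact hV.integral_mul_comp x s t (hZi i) (hZb i) (hGi i)
  · intro i _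
    simp only [hV.transition_apply hG]
    obtain ⟨Bi, -, hBi⟩ := exists_norm_le (hGi i)
    refine Integrable.bdd_mul (c := B) ?_ (hZm i) (Eventually.of_forall (hZb i))
    exact Integrable.of_bound ((hV.measurable_transition (hGi i) t).comp
      (hV.measurable s)).aestronglyMeasurable Bi
      (Eventually.of_forall fun ω => hV.norm_transition_le hBi _ _)
  · intro i _
    exact (hV.integrable_comp (hGi i) (s + t) (P x)).bdd_mul (hZm i)
      (Eventually.of_forall (hZb i))

/-- Averaging over a block of slow time, in terms of a modulus for averages in fast time. -/
theorem IsFellerProcess.norm_integral_transition_timeChange_le (hV : IsFellerProcess 𝓕 P V)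
    (hτ : IsTimeChange τ m) {G : S → EuclideanSpace ℝ (Fin K)} (hG : Continuous G) {B : ℝ}
    (hB : ∀ y, ‖G y‖ ≤ B) {R : ℝ → ℝ} (hR0 : ∀ L, 0 ≤ R L)
    (hR : ∀ L' > 0, ∀ L ≥ L', ∀ x,
      ‖∫ u in (0 : ℝ)..L, transition P V G u.toNNReal x‖ ≤ L * R L')
    {s h L' : ℝ} (hh : 0 < h) (hL' : 0 < L') (hL's : L' ≤ h * m s) (x : S) :
    ‖∫ r in s..(s + h), transition P V G
        ((∫ u in (0 : ℝ)..r, m u) - ∫ u in (0 : ℝ)..s, m u).toNNReal x‖ ≤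
      h * (B * ((m (s + h) - m s) / m s) + m (s + h) / m s * R L') := by
  let T : ℝ → ℝ := fun r => (∫ u in (0 : ℝ)..r, m u) - ∫ u in (0 : ℝ)..s, m u
  let g : ℝ → EuclideanSpace ℝ (Fin K) := fun u => transition P V G u.toNNReal x
  have hT : ∀ r, HasDerivAt T (m r) r := fun r => (hτ.hasDerivAt r).sub_const _
  have hTc : Continuous T := continuous_iff_continuousAt.2 fun r => (hT r).continuousAt
  have hTm : Monotone T := fun a b hab => sub_le_sub_right (hτ.monotone_integral hab) _
  have hB0 : 0 ≤ B := (norm_nonneg _).trans (hB x)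
  have hle : s ≤ s + h := le_add_of_nonneg_right hh.le
  have hgm : Measurable g := measurable_comp_toNNReal (hV.rightCont_transition hG x)
  have hgB : ∀ u, ‖g u‖ ≤ B := fun u => hV.norm_transition_le hB _ _
  have hgi : ∀ a b, IntervalIntegrable (fun r => g (T r)) volume a b := fun a b =>
    (intervalIntegrable_const (c := B)).mono_fun' (hgm.comp hTc.measurable).aestronglyMeasurable
      (Eventually.of_forall fun r => hgB _)
  have hmgi : ∀ a b, IntervalIntegrable (fun r => m r • g (T r)) volume a b := fun a b =>
    (hgi a b).continuousOn_smul hτ.cont.continuousOn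
  have hF : ∀ u, HasDerivWithinAt (fun u => ∫ y in (0 : ℝ)..u, g y) (g u) (Set.Ici u) u := fun u =>
    intervalIntegral.integral_hasDerivWithinAt_right (hV.intervalIntegrable_transition hG x 0 u)
      hgm.stronglyMeasurable.stronglyMeasurableAtFilter
      ((continuousWithinAt_comp_toNNReal (hV.rightCont_transition hG x) u).mono
        Set.Ioi_subset_Ici_self)
  have hFc : Continuous fun u => ∫ y in (0 : ℝ)..u, g y :=
    intervalIntegral.continuous_primitive (fun a b => hV.intervalIntegrable_transition hG x a b) 0
  have hT0 : T s = 0 := sub_self _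
  -- Substitution `u = T r`. Since `g` is only right-continuous, its primitive has only a right
  -- derivative; monotonicity of `T` makes the chain rule valid on that side.
  have hsubst : ∫ r in s..(s + h), m r • g (T r) = ∫ u in (0 : ℝ)..(T (s + h)), g u := by
    rw [intervalIntegral.integral_eq_sub_of_hasDeriv_right_of_le hle
      (f := fun r => ∫ y in (0 : ℝ)..(T r), g y) (hFc.comp hTc).continuousOn
      (fun r _ => ((hF (T r)).scomp r (hT r).hasDerivWithinAt (fun a ha => hTm ha)).mono
        Set.Ioi_subset_Ici_self) (hmgi _ _), hT0, intervalIntegral.integral_same, sub_zero]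
  -- The weight `m r` required by the substitution is compared with the constant `m s`, leaving a
  -- defect controlled by the growth of `m` on the block.
  have hdecomp : m s • ∫ r in s..(s + h), g (T r) =
      (∫ u in (0 : ℝ)..(T (s + h)), g u) - ∫ r in s..(s + h), (m r - m s) • g (T r) := by
    rw [← hsubst, ← intervalIntegral.integral_smul, ← intervalIntegral.integral_sub (hmgi _ _)]
    · refine intervalIntegral.integral_congr fun r _ => ?_
      simp only [sub_smul]
      abel
    · exact (hgi _ _).continuousOn_smul (hτ.cont.sub continuous_const).continuousOn
  have h1 : ‖∫ r in s..(s + h), (m r - m s) • g (T r)‖ ≤ (m (s + h) - m s) * B * h := by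
    have := intervalIntegral.norm_integral_le_of_norm_le_const (a := s) (b := s + h)
      (C := (m (s + h) - m s) * B) (f := fun r => (m r - m s) • g (T r)) fun r hr => by
        rw [Set.uIoc_of_le hle] at hr
        have h2 : 0 ≤ m r - m s := sub_nonneg.2 (hτ.mono hr.1.le)
        rw [norm_smul, Real.norm_of_nonneg h2]
        exact mul_le_mul (sub_le_sub_right (hτ.mono hr.2) _) (hgB _) (norm_nonneg _)
          (h2.trans (sub_le_sub_right (hτ.mono hr.2) _))
    rwa [add_sub_cancel_left, abs_of_pos hh] at this
  have hms := hτ.pos s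
  have hTl : h * m s ≤ T (s + h) := by
    have := hτ.mul_le_integral hle
    rwa [← hτ.integral_sub, add_sub_cancel_left, mul_comm] at this
  have hTu : T (s + h) ≤ h * m (s + h) := by
    have := hτ.integral_le_mul hle
    rwa [← hτ.integral_sub, add_sub_cancel_left, mul_comm] at this
  have h2 : ‖∫ u in (0 : ℝ)..(T (s + h)), g u‖ ≤ h * m (s + h) * R L' :=
    (hR L' hL' _ (hL's.trans hTl) x).trans (mul_le_mul_of_nonneg_right hTu (hR0 _))
  have h3 : m s * ‖∫ r in s..(s + h), g (T r)‖ ≤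
      h * m (s + h) * R L' + (m (s + h) - m s) * B * h := by
    rw [← Real.norm_of_nonneg hms.le, ← norm_smul, Real.norm_of_nonneg hms.le, hdecomp]
    exact (norm_sub_le _ _).trans (add_le_add h2 h1)
  change ‖∫ r in s..(s + h), g (T r)‖ ≤ _
  rw [← mul_le_mul_iff_right₀ hms]
  refine h3.trans (le_of_eq ?_)
  field_simp
  ring

/-- The correlation of an adapted vector with the centred observable over a block is small. -/
theorem IsFellerProcess.abs_integral_inner_integral_le (hV : IsFellerProcess 𝓕 P V)
    (hτ : IsTimeChange τ m) {G : S → EuclideanSpace ℝ (Fin K)} (hG : Continuous G)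
    {s h : ℝ} (hs : 0 ≤ s) (hh : 0 < h) {C : ℝ}
    (hC : ∀ x, ‖∫ r in s..(s + h), transition P V G
        ((∫ u in (0 : ℝ)..r, m u) - ∫ u in (0 : ℝ)..s, m u).toNNReal x‖ ≤ C)
    {Z : Ω → EuclideanSpace ℝ (Fin K)} (hZ : Measurable[𝓕 (τ s.toNNReal)] Z) {A : ℝ}
    (hA : ∀ ω, ‖Z ω‖ ≤ A) (x : S) :
    |∫ ω, inner ℝ (Z ω) (∫ r in s..(s + h), G (V (τ r.toNNReal) ω)) ∂(P x)| ≤ A * C := by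
  have := hV.isProb
  obtain ⟨B, hB0, hB⟩ := exists_norm_le hG
  have hle : s ≤ s + h := le_add_of_nonneg_right hh.le
  let T : ℝ → ℝ := fun r => (∫ u in (0 : ℝ)..r, m u) - ∫ u in (0 : ℝ)..s, m u
  have hTc : Continuous T := continuous_iff_continuousAt.2 fun r =>
    ((hτ.hasDerivAt r).sub_const _).continuousAt
  have hZm : Measurable Z := hZ.mono (𝓕.le _) le_rfl
  have hswap : ∀ {Y : ℝ → Ω → EuclideanSpace ℝ (Fin K)} (_ : Measurable (Function.uncurry Y))
      (_ : ∀ r ω, ‖Y r ω‖ ≤ B),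
      ∫ ω, inner ℝ (Z ω) (∫ r in s..(s + h), Y r ω) ∂(P x) =
        ∫ r in s..(s + h), ∫ ω, inner ℝ (Z ω) (Y r ω) ∂(P x) := by
    intro Y hY hYB
    have h1 : ∀ ω, inner ℝ (Z ω) (∫ r in s..(s + h), Y r ω) =
        ∫ r in s..(s + h), inner ℝ (Z ω) (Y r ω) := fun ω => by
      refine ((innerSL ℝ (Z ω)).intervalIntegral_comp_comm ?_).symm
      exact (intervalIntegrable_const (c := B)).mono_fun'
        (hY.comp (measurable_id.prodMk measurable_const)).aestronglyMeasurable
        (Eventually.of_forall fun r => hYB _ _)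
    rw [integral_congr_ae (Eventually.of_forall h1)]
    simp only [intervalIntegral.integral_of_le hle]
    refine integral_integral_swap ?_
    refine Integrable.of_bound (C := A * B) ?_ (Eventually.of_forall fun p => ?_)
    · exact ((hZm.comp measurable_fst).inner
        (hY.comp (measurable_snd.prodMk measurable_fst))).aestronglyMeasurable
    · exact (norm_inner_le_norm _ _).trans (mul_le_mul (hA _) (hYB _ _) (norm_nonneg _)
        ((norm_nonneg _).trans (hA p.1)))
  rw [hswap (Y := fun r ω => G (V (τ r.toNNReal) ω)) _ (fun r ω => hB _)]
  · have h2 : ∫ r in s..(s + h), ∫ ω, inner ℝ (Z ω) (G (V (τ r.toNNReal) ω)) ∂(P x) =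
        ∫ r in s..(s + h), ∫ ω, inner ℝ (Z ω)
          (transition P V G (T r).toNNReal (V (τ s.toNNReal) ω)) ∂(P x) := by
      refine intervalIntegral.integral_congr fun r hr => ?_
      rw [Set.uIcc_of_le hle] at hr
      simp only [hτ.apply_eq_add hs hr.1]
      exact hV.integral_inner_comp x _ _ hZ hA hG
    rw [h2, ← hswap (Y := fun r ω => transition P V G (T r).toNNReal (V (τ s.toNNReal) ω)) _
      (fun r ω => hV.norm_transition_le hB _ _)]
    · have h3 := norm_integral_le_of_norm_le_const (μ := P x) (C := A * C)
        (f := fun ω => inner ℝ (Z ω)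
          (∫ r in s..(s + h), transition P V G (T r).toNNReal (V (τ s.toNNReal) ω)))
        (Eventually.of_forall fun ω => (norm_inner_le_norm _ _).trans
          (mul_le_mul (hA _) (hC _) (norm_nonneg _) ((norm_nonneg _).trans (hA ω))))
      rwa [probReal_univ, mul_one] at h3
    · exact (hV.measurable_uncurry_transition hG).comp
        ((measurable_real_toNNReal.comp (hTc.measurable.comp measurable_fst)).prodMk
          ((hV.measurable _).comp measurable_snd))
  · exact hG.measurable.comp (hV.measurable_uncurry.comp
      ((hτ.continuous.measurable.comp (measurable_real_toNNReal.comp measurable_fst)).prodMk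
        measurable_snd))

end Expectation

/-! ### The mean-square estimate for gradient processes. -/

section Energy

variable {S : Type u} {Ω : Type v} [TopologicalSpace S] [PolishSpace S]
    [CompactSpace S] [MeasurableSpace S] [BorelSpace S] [mΩ : MeasurableSpace Ω]
    {𝓕 : Filtration ℝ≥0 mΩ} {P : Kernel S Ω} {V : ℝ≥0 → Ω → S} {π : Measure S} {K : ℕ}
    {f : EuclideanSpace ℝ (Fin K) → S → ℝ} {κ : ℝ}
    {τ : ℝ≥0 → ℝ≥0} {m : ℝ → ℝ} {θ₀ : EuclideanSpace ℝ (Fin K)}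
    {ξ : ℝ≥0 → Ω → EuclideanSpace ℝ (Fin K)}

theorem IsGradientProcess.measurable (hξ : IsGradientProcess 𝓕 V f τ θ₀ ξ) (t : ℝ≥0) :
    Measurable (ξ t) :=
  (hξ.adapted t).mono (𝓕.le _) le_rfl

theorem IsGradientProcess.integrable_norm_sq (hξ : IsGradientProcess 𝓕 V f τ θ₀ ξ)
    {θstar : EuclideanSpace ℝ (Fin K)} {t : ℝ≥0} {A : ℝ} (hA : ∀ ω, ‖ξ t ω - θstar‖ ≤ A)
    (Q : Measure Ω) [IsFiniteMeasure Q] : Integrable (fun ω => ‖ξ t ω - θstar‖ ^ 2) Q := by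
  refine Integrable.of_bound (C := A ^ 2)
    (((hξ.measurable t).sub_const θstar).norm.pow_const 2).aestronglyMeasurable
    (Eventually.of_forall fun ω => ?_)
  rw [Real.norm_of_nonneg (by positivity)]
  exact pow_le_pow_left₀ (norm_nonneg _) (hA ω) 2

/-- One step of the energy estimate, in expectation. -/
theorem IsGradientProcess.integral_norm_sq_step_le (hξ : IsGradientProcess 𝓕 V f τ θ₀ ξ)
    (hV : IsFellerProcess 𝓕 P V) (hτ : IsTimeChange τ m) (hf : TargetAssumption f π) (hκ : 0 < κ)
    (hconv : UniformlyStronglyConvex f κ) {θstar : EuclideanSpace ℝ (Fin K)} {A B M C : ℝ}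
    (hB : ∀ y, ‖gradθ f θstar y‖ ≤ B) {s h : ℝ} (hs : 0 ≤ s) (hh : 0 < h)
    (hA : ∀ ω r, s ≤ r → ‖ξ r.toNNReal ω - θstar‖ ≤ A)
    (hM : ∀ θ, ‖θ - θstar‖ ≤ A → ∀ y, ‖gradθ f θ y‖ ≤ M)
    (hC : ∀ x, ‖∫ r in s..(s + h), transition P V (gradθ f θstar)
        ((∫ u in (0 : ℝ)..r, m u) - ∫ u in (0 : ℝ)..s, m u).toNNReal x‖ ≤ C) (x : S) :
    ∫ ω, ‖ξ (s + h).toNNReal ω - θstar‖ ^ 2 ∂(P x) ≤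
      (1 - 2 * κ * h) * ∫ ω, ‖ξ s.toNNReal ω - θstar‖ ^ 2 ∂(P x) +
        (4 * κ * A * M + 2 * M * B) * h ^ 2 + 2 * (A * C) := by
  have := hV.isProb
  have hG := hf.continuous_grad θstar
  have hle : s ≤ s + h := le_add_of_nonneg_right hh.le
  have hjoint : Measurable fun p : Ω × ℝ => gradθ f θstar (V (τ p.2.toNNReal) p.1) :=
    hG.measurable.comp (hV.measurable_uncurry.comp
      ((hτ.continuous.measurable.comp (measurable_real_toNNReal.comp measurable_snd)).prodMk
        measurable_fst))
  have hIm : Measurable fun ω => ∫ r in s..(s + h), gradθ f θstar (V (τ r.toNNReal) ω) := by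
    simp only [intervalIntegral.integral_of_le hle]
    exact hjoint.stronglyMeasurable.integral_prod_right'.measurable
  have hi0 := hξ.integrable_norm_sq (t := s.toNNReal) (fun ω => hA ω s le_rfl) (P x)
  have hi1 := hξ.integrable_norm_sq (t := (s + h).toNNReal) (fun ω => hA ω (s + h) hle) (P x)
  have hi2 : Integrable (fun ω => inner ℝ (ξ s.toNNReal ω - θstar)
      (∫ r in s..(s + h), gradθ f θstar (V (τ r.toNNReal) ω))) (P x) := by
    refine Integrable.of_bound (C := A * (B * h))
      (((hξ.measurable _).sub_const θstar).inner hIm).aestronglyMeasurable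
      (Eventually.of_forall fun ω => ?_)
    refine (norm_inner_le_norm _ _).trans (mul_le_mul (hA ω s le_rfl) ?_ (norm_nonneg _)
      ((norm_nonneg _).trans (hA ω s le_rfl)))
    have h1 := intervalIntegral.norm_integral_le_of_norm_le_const (a := s) (b := s + h) (C := B)
      (f := fun r : ℝ => gradθ f θstar (V (τ r.toNNReal) ω)) fun r _ => hB _
    rwa [add_sub_cancel_left, abs_of_pos hh] at h1
  have hi3 : Integrable (fun ω => (1 - 2 * κ * h) * ‖ξ s.toNNReal ω - θstar‖ ^ 2 +
      (4 * κ * A * M + 2 * M * B) * h ^ 2) (P x) :=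
    (hi0.const_mul _).add (integrable_const _)
  have hmono := integral_mono hi1 (hi3.sub (hi2.const_mul 2)) fun ω =>
    (hξ.isGradientPath hV hτ ω).norm_sq_step_le hf hκ hconv hB hs hh.le
      (fun r hr => hA ω r hr) (fun r hr y => hM _ (hA ω r hr) y)
  simp only [Pi.sub_apply] at hmono
  rw [integral_sub hi3 (hi2.const_mul 2), integral_add (hi0.const_mul _) (integrable_const _),
    integral_const_mul, integral_const (μ := P x), probReal_univ, one_smul,
    integral_const_mul] at hmono
  have hcorr := hV.abs_integral_inner_integral_le hτ hG hs hh hC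
    ((hξ.adapted s.toNNReal).sub_const θstar) (fun ω => hA ω s le_rfl) x
  have := (abs_le.1 hcorr).1
  linarith

/-- With the forcing written as `(1 - q) * D`, the affine recursion has fixed point `D`, so errors
do not accumulate with the number of steps. -/
theorem le_geometric_of_step {e : ℕ → ℝ} {q D E : ℝ} (hq0 : 0 ≤ q) (h0 : e 0 ≤ E)
    {n : ℕ} (hstep : ∀ k < n, e (k + 1) ≤ q * e k + (1 - q) * D) (hD : 0 ≤ D) :
    e n ≤ q ^ n * E + D := by
  have : ∀ k ≤ n, e k ≤ q ^ k * E + D := by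
    intro k
    induction k with
    | zero => intro _; simpa using h0.trans (le_add_of_nonneg_right hD)
    | succ k ih =>
      intro hk
      have h1 := ih (Nat.le_of_succ_le hk)
      have h2 := hstep k hk
      have h3 : q * e k ≤ q * (q ^ k * E + D) := mul_le_mul_of_nonneg_left h1 hq0
      calc e (k + 1) ≤ q * (q ^ k * E + D) + (1 - q) * D := by linarith
        _ = q ^ (k + 1) * E + D := by ring
  exact this n le_rfl

/-- The mean-square distance of a gradient process to the zero of the mean gradient. -/
theorem exists_integral_norm_sq_le [IsProbabilityMeasure π] (hV : IsFellerProcess 𝓕 P V)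
    (huniq : ∀ ν : Measure S, IsInvariantFor P V ν → ν = π) (hf : TargetAssumption f π)
    (hκ : 0 < κ) (hconv : UniformlyStronglyConvex f κ) {θstar : EuclideanSpace ℝ (Fin K)}
    (h0 : ∫ y, gradθ f θstar y ∂π = 0) :
    ∃ C > (0 : ℝ), ∃ R : ℝ → ℝ, (∀ L, 0 ≤ R L) ∧ Tendsto R atTop (𝓝 0) ∧
      ∀ N : ℝ, ∃ t₀ ≥ (0 : ℝ), ∀ (τ : ℝ≥0 → ℝ≥0) (m : ℝ → ℝ), IsTimeChange τ m →
        ∀ θ₀, ‖θ₀ - θstar‖ ≤ N → ∀ ξ, IsGradientProcess 𝓕 V f τ θ₀ ξ →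
        ∀ (s h L : ℝ) (n : ℕ), t₀ ≤ s → 0 < h → 2 * κ * h ≤ 1 → 0 < L → L ≤ h * m s →
          m (s + n * h) ≤ 2 * m s → ∀ x,
          Integrable (fun ω => ‖ξ (s + n * h).toNNReal ω - θstar‖ ^ 2) (P x) ∧
          ∫ ω, ‖ξ (s + n * h).toNNReal ω - θstar‖ ^ 2 ∂(P x) ≤
            C * (Real.exp (-2 * κ * (n * h)) + h + (m (s + n * h) - m s) / m s + R L) := by
  have hprob := hV.isProb
  have hG := hf.continuous_grad θstar
  obtain ⟨B, hB0, hB⟩ := exists_norm_le hG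
  obtain ⟨R, hR0, hRlim, hR⟩ := hV.exists_averageModulus huniq hG h0
  -- Radius of the absorbing ball: `B²/κ²` from the forcing, plus `1` for what remains of the
  -- initial distance after `t₀`. It does not involve `N`, hence neither do `M`, `D` and `C`.
  let A : ℝ := Real.sqrt (1 + B ^ 2 / κ ^ 2)
  have hA0 : 0 ≤ A := Real.sqrt_nonneg _
  have hA2 : A ^ 2 = 1 + B ^ 2 / κ ^ 2 := Real.sq_sqrt (by positivity)
  obtain ⟨M, hM0, hM⟩ := hf.exists_norm_grad_le (isCompact_closedBall θstar A)
  have hM' : ∀ θ, ‖θ - θstar‖ ≤ A → ∀ y, ‖gradθ f θ y‖ ≤ M := fun θ hθ y =>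
    hM θ (mem_closedBall_iff_norm.2 hθ) y
  let D : ℝ := 4 * κ * A * M + 2 * M * B
  have hD0 : 0 ≤ D := by positivity
  -- The summands dominate the initial energy, the freezing error and the averaging error, the last
  -- two divided by the contraction `2κh` per step.
  let C : ℝ := A ^ 2 + D / (2 * κ) + A * (B + 2) / κ
  have hA2pos : 0 < A ^ 2 := by rw [hA2]; positivity
  have hCpos : 0 < C := by positivity
  refine ⟨C, hCpos, R, hR0, hRlim, fun N => ?_⟩
  obtain ⟨t₀, ht₀0, ht₀⟩ : ∃ t₀ ≥ (0 : ℝ), ∀ t ≥ t₀, Real.exp (-κ * t) * N ^ 2 ≤ 1 := by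
    have h1 : Tendsto (fun t : ℝ => Real.exp (-κ * t) * N ^ 2) atTop (𝓝 (0 * N ^ 2)) :=
      (Real.tendsto_exp_atBot.comp
        (tendsto_id.const_mul_atTop_of_neg (neg_lt_zero.2 hκ))).mul_const _
    rw [zero_mul] at h1
    obtain ⟨t₁, ht₁⟩ := eventually_atTop.1 (h1.eventually (ge_mem_nhds one_pos))
    exact ⟨max t₁ 0, le_max_right _ _, fun t ht => ht₁ t ((le_max_left _ _).trans ht)⟩
  refine ⟨t₀, ht₀0, fun τ m hτ θ₀ hθ₀ ξ hξ s h L n hs hh hκh hL hLs hm x => ?_⟩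
  have hs0 : 0 ≤ s := ht₀0.trans hs
  have habs : ∀ ω r, s ≤ r → ‖ξ r.toNNReal ω - θstar‖ ≤ A := by
    intro ω r hr
    refine le_of_sq_le_sq ?_ hA0
    rw [hA2]
    have h1 := (hξ.isGradientPath hV hτ ω).norm_sq_le hf hκ hconv hB r.toNNReal
    rw [Real.coe_toNNReal r (hs0.trans hr)] at h1
    have h2 : Real.exp (-κ * r) * ‖θ₀ - θstar‖ ^ 2 ≤ 1 :=
      (mul_le_mul_of_nonneg_left (pow_le_pow_left₀ (norm_nonneg _) hθ₀ 2)
        (Real.exp_pos _).le).trans (ht₀ r (hs.trans hr))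
    linarith
  refine ⟨hξ.integrable_norm_sq (fun ω => habs ω _ (le_add_of_nonneg_right (by positivity))) _, ?_⟩
  let u : ℝ := (m (s + n * h) - m s) / m s
  have hms := hτ.pos s
  have hu0 : 0 ≤ u := div_nonneg (sub_nonneg.2 (hτ.mono (le_add_of_nonneg_right (by positivity))))
    hms.le
  let e : ℕ → ℝ := fun k => ∫ ω, ‖ξ (s + k * h).toNNReal ω - θstar‖ ^ 2 ∂(P x)
  have hblock : ∀ k < n, ∀ y, ‖∫ r in (s + k * h)..(s + k * h + h), transition P V
      (gradθ f θstar) ((∫ u in (0 : ℝ)..r, m u) - ∫ u in (0 : ℝ)..(s + k * h), m u).toNNReal y‖ ≤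
      h * (B * u + 2 * R L) := by
    intro k hk y
    have hk1 : s ≤ s + k * h := le_add_of_nonneg_right (by positivity)
    have hkn : s + k * h + h ≤ s + n * h := by
      have : ((k + 1 : ℕ) : ℝ) * h ≤ n * h :=
        mul_le_mul_of_nonneg_right (by exact_mod_cast hk) hh.le
      push_cast at this
      linarith
    -- As `m` is non-decreasing, every block lasts at least `L` in fast time, and its relative
    -- increment is at most that of the whole interval.
    have hmk : m s ≤ m (s + k * h) := hτ.mono hk1
    have hmk' : m (s + k * h + h) ≤ m (s + n * h) := hτ.mono hkn
    have hmk0 := hτ.pos (s + k * h)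
    refine (hV.norm_integral_transition_timeChange_le hτ hG hB hR0 hR hh hL
      (hLs.trans (mul_le_mul_of_nonneg_left hmk hh.le)) y).trans ?_
    have h1 : (m (s + k * h + h) - m (s + k * h)) / m (s + k * h) ≤ u :=
      div_le_div₀ (sub_nonneg.2 (hmk.trans ((hτ.mono (le_add_of_nonneg_right hh.le)).trans hmk')))
        (by linarith) hms hmk
    have h2 : m (s + k * h + h) / m (s + k * h) ≤ 2 := by
      rw [div_le_iff₀ hmk0]
      linarith
    gcongr
    exact hR0 L
  have hstep : ∀ k < n, e (k + 1) ≤ (1 - 2 * κ * h) * e k +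
      (1 - (1 - 2 * κ * h)) * ((D * h + 2 * A * (B * u + 2 * R L)) / (2 * κ)) := by
    intro k hk
    have hk1 : s ≤ s + k * h := le_add_of_nonneg_right (by positivity)
    have h1 := hξ.integral_norm_sq_step_le hV hτ hf hκ hconv hB (hs0.trans hk1) hh
      (fun ω r hr => habs ω r (hk1.trans hr)) hM' (hblock k hk) x
    have h2 : e (k + 1) = ∫ ω, ‖ξ (s + k * h + h).toNNReal ω - θstar‖ ^ 2 ∂(P x) := by
      simp only [e]
      push_cast
      rw [add_mul, one_mul, add_assoc]
    rw [h2]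
    refine h1.trans (le_of_eq ?_)
    simp only [e, D]
    field_simp
    ring
  have hRL := hR0 L
  have hfin := le_geometric_of_step (e := e) (E := A ^ 2) (by linarith) ?_ hstep
    (by positivity)
  · have hq : (1 - 2 * κ * h) ^ n ≤ Real.exp (-2 * κ * (n * h)) := by
      have h1 : 1 - 2 * κ * h ≤ Real.exp (-(2 * κ * h)) := Real.one_sub_le_exp_neg _
      calc _ ≤ Real.exp (-(2 * κ * h)) ^ n := pow_le_pow_left₀ (by linarith) h1 n
        _ = _ := by rw [← Real.exp_nat_mul]; congr 1; ring
    refine hfin.trans ?_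
    change _ ≤ C * (Real.exp (-2 * κ * (n * h)) + h + u + R L)
    have hE := (Real.exp_pos (-2 * κ * (n * h))).le
    have h3 : (1 - 2 * κ * h) ^ n * A ^ 2 ≤ C * Real.exp (-2 * κ * (n * h)) := by
      rw [mul_comm]
      refine mul_le_mul ?_ hq (pow_nonneg (by linarith) n) hCpos.le
      have : 0 ≤ D / (2 * κ) + A * (B + 2) / κ := by positivity
      simp only [C]
      linarith
    have h4 : D / (2 * κ) * h ≤ C * h := by
      refine mul_le_mul_of_nonneg_right ?_ hh.le
      have : 0 ≤ A ^ 2 + A * (B + 2) / κ := by positivity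
      simp only [C]
      linarith
    have h5 : A * (B + 2) / κ * (u + R L) ≤ C * (u + R L) := by
      refine mul_le_mul_of_nonneg_right ?_ (by positivity)
      have : 0 ≤ A ^ 2 + D / (2 * κ) := by positivity
      simp only [C]
      linarith
    have h6 : (D * h + 2 * A * (B * u + 2 * R L)) / (2 * κ) =
        D / (2 * κ) * h + A / κ * (B * u + 2 * R L) := by field_simp
    have h7 : A / κ * (B * u + 2 * R L) ≤ A * (B + 2) / κ * (u + R L) := by
      rw [mul_div_right_comm, mul_assoc]
      refine mul_le_mul_of_nonneg_left ?_ (by positivity)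
      nlinarith [mul_nonneg hB0 hRL]
    rw [h6]
    linarith
  · have h1 := integral_mono (hξ.integrable_norm_sq (fun ω => habs ω s le_rfl) (P x))
      (integrable_const (A ^ 2))
      (fun ω => pow_le_pow_left₀ (norm_nonneg _) (habs ω s le_rfl) 2)
    simpa [e] using h1

end Energy

/-! ### Bounds on the Wasserstein distance to a Dirac mass. -/

theorem wasserstein_dirac_le {K : ℕ} (ν : Measure (EuclideanSpace ℝ (Fin K)))
    [IsProbabilityMeasure ν] (θstar : EuclideanSpace ℝ (Fin K)) :
    wasserstein ν (Measure.dirac θstar) ≤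
      ∫⁻ y, ENNReal.ofReal (min 1 ‖y - θstar‖) ∂ν := by
  refine (iInf₂_le (ν.prod (Measure.dirac θstar)) ⟨inferInstance, by simp, by simp⟩).trans
    (le_of_eq ?_)
  have hm : Measurable fun p : EuclideanSpace ℝ (Fin K) × EuclideanSpace ℝ (Fin K) =>
      ENNReal.ofReal (min 1 ‖p.1 - p.2‖) := by fun_prop
  rw [lintegral_prod _ hm.aemeasurable]
  refine lintegral_congr fun y => ?_
  rw [lintegral_dirac' _ (by fun_prop)]

theorem wasserstein_dirac_le_one {K : ℕ} (ν : Measure (EuclideanSpace ℝ (Fin K)))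
    [IsProbabilityMeasure ν] (θstar : EuclideanSpace ℝ (Fin K)) :
    wasserstein ν (Measure.dirac θstar) ≤ 1 := by
  refine (wasserstein_dirac_le ν θstar).trans ?_
  calc _ ≤ ∫⁻ _y, 1 ∂ν := lintegral_mono fun y => by
        rw [← ENNReal.ofReal_one]
        exact ENNReal.ofReal_le_ofReal (min_le_left _ _)
    _ = 1 := by simp

/-- The passage from mean square to mean is the nonnegativity of the variance. -/
theorem lintegral_min_one_norm_le {Ω : Type*} [MeasurableSpace Ω] {K : ℕ} {Q : Measure Ω}
    [IsProbabilityMeasure Q] {X : Ω → EuclideanSpace ℝ (Fin K)} (hX : Measurable X)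
    (hi : Integrable (fun ω => ‖X ω‖ ^ 2) Q) :
    ∫⁻ ω, ENNReal.ofReal (min 1 ‖X ω‖) ∂Q ≤ ENNReal.ofReal (Real.sqrt (∫ ω, ‖X ω‖ ^ 2 ∂Q)) := by
  have h2 : MemLp (fun ω => ‖X ω‖) 2 Q :=
    (memLp_two_iff_integrable_sq hX.norm.aestronglyMeasurable).2 hi
  have h1 : Integrable (fun ω => ‖X ω‖) Q := h2.integrable (by norm_num)
  have hsq : (∫ ω, ‖X ω‖ ∂Q) ^ 2 ≤ ∫ ω, ‖X ω‖ ^ 2 ∂Q := by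
    have hv := variance_nonneg (fun ω => ‖X ω‖) Q
    rw [variance_eq_sub h2] at hv
    simpa using hv
  calc _ ≤ ∫⁻ ω, ENNReal.ofReal ‖X ω‖ ∂Q :=
        lintegral_mono fun ω => ENNReal.ofReal_le_ofReal (min_le_right _ _)
    _ = ENNReal.ofReal (∫ ω, ‖X ω‖ ∂Q) :=
        (ofReal_integral_eq_lintegral_ofReal h1
          (Eventually.of_forall fun ω => norm_nonneg _)).symm
    _ ≤ _ := ENNReal.ofReal_le_ofReal (Real.le_sqrt_of_sq_le hsq)

/-- This form needs no moments of `ν`, as is required for a stationary law about which only tail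
bounds are available. -/
theorem lintegral_min_one_norm_le_add {K : ℕ} (ν : Measure (EuclideanSpace ℝ (Fin K)))
    [IsProbabilityMeasure ν] (θstar : EuclideanSpace ℝ (Fin K)) {c : ℝ} :
    ∫⁻ y, ENNReal.ofReal (min 1 ‖y - θstar‖) ∂ν ≤
      ENNReal.ofReal c + ν {y | c < ‖y - θstar‖} := by
  have hm : MeasurableSet {y : EuclideanSpace ℝ (Fin K) | c < ‖y - θstar‖} :=
    measurableSet_lt measurable_const (by fun_prop)
  calc _ ≤ ∫⁻ y, (ENNReal.ofReal c +
        {y | c < ‖y - θstar‖}.indicator (fun _ => (1 : ℝ≥0∞)) y) ∂ν := by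
        refine lintegral_mono fun y => ?_
        by_cases hy : c < ‖y - θstar‖
        · rw [Set.indicator_of_mem (by exact hy)]
          refine le_add_left ?_
          rw [← ENNReal.ofReal_one]
          exact ENNReal.ofReal_le_ofReal (min_le_left _ _)
        · rw [Set.indicator_of_notMem (by exact hy), add_zero]
          exact ENNReal.ofReal_le_ofReal ((min_le_right _ _).trans (not_lt.1 hy))
    _ = _ := by
        rw [lintegral_add_left measurable_const, lintegral_const, measure_univ, mul_one,
          lintegral_indicator_const hm, one_mul]

/-! ### Rate functions and their time changes. -/

/-- By the mean value theorem, for some `c` in `(t/2, t)` the increment is `μ'(c) t/2 ≤ μ'(c) c`,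
which is a small multiple of `μ(c) ≤ μ(t)`. -/
theorem RateAssumption.tendsto_increment {μ : ℝ → ℝ} (hμ : RateAssumption μ) :
    Tendsto (fun t => (μ t - μ (t / 2)) / μ t) atTop (𝓝 0) := by
  rw [Metric.tendsto_atTop]
  intro ε hε
  obtain ⟨T, hT⟩ := eventually_atTop.1 (hμ.slow.eventually (gt_mem_nhds (half_pos hε)))
  refine ⟨max (2 * T) 1, fun t ht => ?_⟩
  have ht1 : 1 ≤ t := (le_max_right _ _).trans ht
  have htT : T ≤ t / 2 := by linarith [(le_max_left (2 * T) 1).trans ht]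
  have ht0 : 0 < t / 2 := by linarith
  have hsub : Set.Icc (t / 2) t ⊆ Set.Ici 0 := fun r hr => ht0.le.trans hr.1
  have hnhds : ∀ r, 0 < r → Set.Ici (0 : ℝ) ∈ 𝓝 r := fun r hr => Ici_mem_nhds hr
  obtain ⟨c, hc, hslope⟩ := exists_deriv_eq_slope μ (show t / 2 < t by linarith)
    (hμ.contDiff.continuousOn.mono hsub)
    (fun r hr => ((hμ.contDiff.differentiableOn (by norm_num) r
      (ht0.le.trans hr.1.le)).differentiableAt
        (hnhds r (ht0.trans hr.1))).differentiableWithinAt)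
  have hc0 : 0 < c := ht0.trans hc.1
  have hslow := hT c (htT.trans hc.1.le)
  rw [derivWithin_of_mem_nhds (hnhds c hc0), div_lt_iff₀ (hμ.pos c hc0.le)] at hslow
  have hμt : 0 < μ t := hμ.pos t (by linarith)
  have hinc : 0 ≤ μ t - μ (t / 2) :=
    sub_nonneg.2 (hμ.mono ht0.le (show (0 : ℝ) ≤ t by linarith) (by linarith))
  have hd : deriv μ c * (t / 2) = μ t - μ (t / 2) := by
    rw [hslope]
    have : t - t / 2 = t / 2 := by ring
    rw [this]
    field_simp
  have hd0 : 0 ≤ deriv μ c := by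
    rw [hslope]
    exact div_nonneg hinc (by linarith)
  have hμc : μ c ≤ μ t := hμ.mono hc0.le (show (0 : ℝ) ≤ t by linarith) hc.2.le
  rw [Real.dist_0_eq_abs, abs_of_nonneg (div_nonneg hinc hμt.le), div_lt_iff₀ hμt, ← hd]
  have h1 : deriv μ c * (t / 2) ≤ deriv μ c * c := mul_le_mul_of_nonneg_left hc.1.le hd0
  have h2 : ε / 2 * μ c ≤ ε / 2 * μ t := by gcongr
  have h3 : 0 < ε / 2 * μ t := by positivity
  linarith

theorem RateAssumption.tendsto_rateA {μ ρ : ℝ → ℝ} (hμ : RateAssumption μ) {κ : ℝ} (hκ : 0 < κ)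
    (hρ : Tendsto ρ (𝓝[>] 0) (𝓝 0)) : Tendsto (rateA κ μ ρ) atTop (𝓝 0) := by
  have h1 : Tendsto (fun t : ℝ => Real.exp (-κ * t / 8)) atTop (𝓝 0) :=
    Real.tendsto_exp_atBot.comp ((tendsto_id.const_mul_atTop_of_neg
      (neg_lt_zero.2 hκ)).atBot_div_const (by norm_num))
  have h2 : Tendsto (fun t => Real.sqrt ((μ t - μ (t / 2)) / μ t)) atTop (𝓝 0) := by
    simpa using hμ.tendsto_increment.sqrt
  have h3 : Tendsto (fun t : ℝ => ρ (1 / μ (t / 2))) atTop (𝓝 0) := by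
    refine hρ.comp ?_
    simp only [one_div]
    exact tendsto_inv_atTop_nhdsGT_zero.comp
      (hμ.tendsto.comp (tendsto_id.atTop_div_const (by norm_num)))
  have h4 := (h1.add h2).add h3
  simp only [add_zero] at h4
  exact h4

theorem isTimeChange_const {ε : ℝ} (hε : 0 < ε) :
    IsTimeChange (fun t => t / ε.toNNReal) fun _ => ε⁻¹ where
  cont := continuous_const
  pos _ := inv_pos.2 hε
  mono := monotone_const
  coe_eq t := by simp [hε.le, div_eq_mul_inv]

/-- Freezing `μ` at its value at `0` for negative times gives a rate that is continuous, positive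
and monotone on the whole line. -/
theorem RateAssumption.isTimeChange {μ : ℝ → ℝ} (hμ : RateAssumption μ) :
    IsTimeChange (rescaledTime μ) fun r => μ (max r 0) where
  cont := hμ.contDiff.continuousOn.comp_continuous (continuous_id.max continuous_const)
    fun r => le_max_right r 0
  pos r := hμ.pos _ (le_max_right _ _)
  mono _ _ h := hμ.mono (Set.mem_Ici.2 (le_max_right _ _))
    (Set.mem_Ici.2 (le_max_right _ _)) (max_le_max_right 0 h)
  coe_eq t := by
    rw [rescaledTime, Real.coe_toNNReal]
    · refine intervalIntegral.integral_congr fun r hr => ?_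
      rw [Set.uIcc_of_le t.coe_nonneg] at hr
      simp [max_eq_left hr.1]
    · refine intervalIntegral.integral_nonneg t.coe_nonneg fun r hr => (hμ.pos r hr.1).le

/-- Chebyshev bound for the first marginal of a stationary measure. -/
theorem IsStationarySGPC.measure_lt_le {S : Type u} {Ω : Type v} [TopologicalSpace S]
    [MeasurableSpace S] [mΩ : MeasurableSpace Ω] {𝓕 : Filtration ℝ≥0 mΩ} {P : Kernel S Ω}
    {V : ℝ≥0 → Ω → S} [IsMarkovKernel P] {K : ℕ} {f : EuclideanSpace ℝ (Fin K) → S → ℝ} {ε : ℝ}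
    {Pst : Measure (EuclideanSpace ℝ (Fin K) × S)} (hst : IsStationarySGPC 𝓕 P V f ε Pst)
    {θstar : EuclideanSpace ℝ (Fin K)} {D : ℝ}
    (hD : ∀ N : ℝ, ∀ η > 0, ∃ t : ℝ≥0, ∀ θ₀, ‖θ₀ - θstar‖ ≤ N → ∀ ξ, IsSGPC 𝓕 V f ε θ₀ ξ →
      ∀ x, Integrable (fun ω => ‖ξ t ω - θstar‖ ^ 2) (P x) ∧
        ∫ ω, ‖ξ t ω - θstar‖ ^ 2 ∂(P x) ≤ D + η) {c : ℝ} (hc : 0 < c) :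
    Pst.map Prod.fst {y | c < ‖y - θstar‖} ≤ ENNReal.ofReal (D / c ^ 2) := by
  obtain ⟨hprob, θ, hθ, hinv⟩ := hst
  have hmeas : ∀ a : ℝ, MeasurableSet {z : EuclideanSpace ℝ (Fin K) × S | a < ‖z.1 - θstar‖} :=
    fun a => measurableSet_lt measurable_const (by fun_prop)
  -- Nothing is assumed on the moments of `Pst`: starting points outside a ball of radius `N` are
  -- charged their full mass, and Chebyshev's inequality handles the others at a time depending on
  -- `N`. Stationarity makes the left side free of that time, so `N → ∞` and `η → 0` are allowed.
  have hbound : ∀ N : ℝ, ∀ η > 0, Pst {z | c < ‖z.1 - θstar‖} ≤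
      Pst {z | N < ‖z.1 - θstar‖} + ENNReal.ofReal ((D + η) / c ^ 2) := by
    intro N η hη
    obtain ⟨t, ht⟩ := hD N η hη
    rw [hinv t _ (hmeas c)]
    calc _ ≤ ∫⁻ z, ({z : EuclideanSpace ℝ (Fin K) × S | N < ‖z.1 - θstar‖}.indicator
          (fun _ => (1 : ℝ≥0∞)) z + ENNReal.ofReal ((D + η) / c ^ 2)) ∂Pst := by
          refine lintegral_mono fun z => ?_
          by_cases hz : N < ‖z.1 - θstar‖
          · rw [Set.indicator_of_mem (by exact hz)]
            exact le_add_right prob_le_one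
          · rw [Set.indicator_of_notMem (by exact hz), zero_add]
            obtain ⟨hi, hle⟩ := ht z.1 (not_lt.1 hz) (θ z.1) (hθ z.1) z.2
            have hch := mul_meas_ge_le_integral_of_nonneg
              (Eventually.of_forall fun ω => sq_nonneg ‖θ z.1 t ω - θstar‖) hi (c ^ 2)
            refine (measure_mono (t := {ω | c ^ 2 ≤ ‖θ z.1 t ω - θstar‖ ^ 2})
              fun ω hω => ?_).trans ?_
            · exact pow_le_pow_left₀ hc.le (le_of_lt hω) 2
            · rw [← ofReal_measureReal]
              refine ENNReal.ofReal_le_ofReal ?_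
              rw [le_div_iff₀' (by positivity)]
              exact hch.trans hle
      _ = _ := by
          rw [lintegral_add_right _ measurable_const, lintegral_const, measure_univ, mul_one,
            lintegral_indicator_const (hmeas N), one_mul]
  have hlimN : Tendsto (fun N : ℕ => Pst {z | (N : ℝ) < ‖z.1 - θstar‖}) atTop (𝓝 0) := by
    have hanti : Antitone fun N : ℕ =>
        {z : EuclideanSpace ℝ (Fin K) × S | (N : ℝ) < ‖z.1 - θstar‖} :=
      fun a b hab z (hz : (b : ℝ) < _) =>
        show (a : ℝ) < _ from lt_of_le_of_lt (Nat.cast_le.2 hab) hz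
    have h1 := tendsto_measure_iInter_atTop (μ := Pst)
      (fun N : ℕ => (hmeas N).nullMeasurableSet) hanti ⟨0, measure_ne_top _ _⟩
    have h2 : ⋂ N : ℕ, {z : EuclideanSpace ℝ (Fin K) × S | (N : ℝ) < ‖z.1 - θstar‖} = ∅ := by
      refine Set.eq_empty_of_forall_notMem fun z hz => ?_
      obtain ⟨N, hN⟩ := exists_nat_ge ‖z.1 - θstar‖
      exact (Set.mem_iInter.1 hz N).not_ge hN
    rwa [h2, measure_empty] at h1
  have hη : Tendsto (fun N : ℕ => ENNReal.ofReal ((D + 1 / ((N : ℝ) + 1)) / c ^ 2)) atTop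
      (𝓝 (ENNReal.ofReal (D / c ^ 2))) := by
    refine ENNReal.tendsto_ofReal ?_
    have := ((tendsto_one_div_add_atTop_nhds_zero_nat (𝕜 := ℝ)).const_add D).div_const (c ^ 2)
    rwa [add_zero] at this
  have hlim := hlimN.add hη
  rw [zero_add] at hlim
  rw [Measure.map_apply measurable_fst (measurableSet_lt measurable_const (by fun_prop))]
  exact ge_of_tendsto' hlim fun N => hbound N _ (by positivity)

/-- Cutting an interval of length `a` into equal pieces of length between `b / 2` and `b`. -/
theorem exists_nat_mul_eq {a b : ℝ} (hb : 0 < b) (hab : b ≤ a) :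
    ∃ (n : ℕ) (h : ℝ), 0 < h ∧ n * h = a ∧ h ≤ b ∧ b / 2 ≤ h := by
  have ha : 0 < a := hb.trans_le hab
  have h1 : 1 ≤ a / b := (one_le_div hb).2 hab
  have hn : 0 < (⌈a / b⌉₊ : ℝ) := by
    exact_mod_cast Nat.ceil_pos.2 (by linarith)
  refine ⟨⌈a / b⌉₊, a / ⌈a / b⌉₊, by positivity, by field_simp, ?_, ?_⟩
  · rw [div_le_iff₀ hn, ← div_le_iff₀' hb]
    exact Nat.le_ceil _
  · rw [le_div_iff₀ hn]
    -- Rounding up at most doubles a number that is at least `1`, whence the lower bound `b / 2`.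
    have h2 : (⌈a / b⌉₊ : ℝ) ≤ 2 * (a / b) := by
      have := (Nat.ceil_lt_add_one (a := a / b) (by linarith)).le
      linarith
    calc b / 2 * (⌈a / b⌉₊ : ℝ) ≤ b / 2 * (2 * (a / b)) := by gcongr
      _ = a := by field_simp

/-- Reconciles the exponent `1/2` obtained for the decreasing rate with the `1/3` built into `ρ`. -/
theorem sqrt_le_rpow_third {b : ℝ} (h0 : 0 ≤ b) (h1 : b ≤ 1) :
    Real.sqrt b ≤ b ^ (1 / 3 : ℝ) := by
  rw [Real.sqrt_eq_rpow]
  rcases h0.eq_or_lt with rfl | hpos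
  · simp
  · exact Real.rpow_le_rpow_of_exponent_ge hpos h1 (by norm_num)

theorem sqrt_add_add_le {a b c : ℝ} (ha : 0 ≤ a) (hb : 0 ≤ b) (hc : 0 ≤ c) :
    Real.sqrt (a + b + c) ≤ Real.sqrt a + Real.sqrt b + Real.sqrt c := by
  rw [Real.sqrt_le_left (by positivity)]
  nlinarith [Real.sq_sqrt ha, Real.sq_sqrt hb, Real.sq_sqrt hc,
    mul_nonneg (Real.sqrt_nonneg a) (Real.sqrt_nonneg b),
    mul_nonneg (Real.sqrt_nonneg a) (Real.sqrt_nonneg c),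
    mul_nonneg (Real.sqrt_nonneg b) (Real.sqrt_nonneg c)]

theorem wasserstein_map_dirac_le {Ω : Type*} [MeasurableSpace Ω] {K : ℕ} {Q : Measure Ω}
    [IsProbabilityMeasure Q] {X : Ω → EuclideanSpace ℝ (Fin K)} (hX : Measurable X)
    (θstar : EuclideanSpace ℝ (Fin K)) :
    wasserstein (Q.map X) (Measure.dirac θstar) ≤
      ∫⁻ ω, ENNReal.ofReal (min 1 ‖X ω - θstar‖) ∂Q := by
  have : IsProbabilityMeasure (Q.map X) := Measure.isProbabilityMeasure_map hX.aemeasurable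
  refine (wasserstein_dirac_le _ θstar).trans (le_of_eq ?_)
  rw [lintegral_map (by fun_prop) hX]

end SGP

end

/-! ### The main theorem. -/

theorem mainTheorem3 {S : Type u} {Ω : Type v} [TopologicalSpace S] [PolishSpace S]
    [CompactSpace S] [MeasurableSpace S] [BorelSpace S] [mΩ : MeasurableSpace Ω] {K : ℕ}
    (𝓕 : Filtration ℝ≥0 mΩ) (P : Kernel S Ω) (V : ℝ≥0 → Ω → S) (π : Measure S)
    (hV : SGP.IndexProcessAssumption.{u, v, w} 𝓕 P V π)
    (f : EuclideanSpace ℝ (Fin K) → S → ℝ) (hf : SGP.TargetAssumption f π)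
    (κ : ℝ) (hκ : 0 < κ) (hconv : SGP.UniformlyStronglyConvex f κ) :
    ∃ θstar : EuclideanSpace ℝ (Fin K),
      -- `θstar` is the unique minimizer of the full target function
      (∀ θ, SGP.fullTarget f π θstar ≤ SGP.fullTarget f π θ) ∧
      (∀ θ', (∀ θ, SGP.fullTarget f π θ' ≤ SGP.fullTarget f π θ) → θ' = θstar) ∧
      -- `ρ` depends only on the index process and on `f`
      ∃ ρ : ℝ → ℝ,
        (∀ ε ∈ Set.Ioo (0 : ℝ) 1, ρ ε ∈ Set.Icc (0 : ℝ) 1) ∧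
        Tendsto ρ (𝓝[>] 0) (𝓝 0) ∧
        (∀ ε ∈ Set.Ioo (0 : ℝ) 1, ∀ Pst : Measure (EuclideanSpace ℝ (Fin K) × S),
          SGP.IsStationarySGPC 𝓕 P V f ε Pst →
          SGP.wasserstein (Pst.map Prod.fst) (Measure.dirac θstar) ≤ ENNReal.ofReal (ρ ε)) ∧
        ∀ μ : ℝ → ℝ, SGP.RateAssumption μ →
          Tendsto (SGP.rateA κ μ ρ) atTop (𝓝 0) ∧
          ∀ θ₀ : EuclideanSpace ℝ (Fin K), ∃ C > (0 : ℝ),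
            ∀ ξ : ℝ≥0 → Ω → EuclideanSpace ℝ (Fin K), SGP.IsSGPD 𝓕 V f μ θ₀ ξ →
            ∀ a : S, ∃ T > (0 : ℝ), ∀ t : ℝ≥0, T < t →
              SGP.wasserstein ((SGP.lawFrom P π).map (ξ t)) (Measure.dirac θstar)
                ≤ ENNReal.ofReal (C * SGP.rateA κ μ ρ t) ∧
              SGP.wasserstein ((P a).map (ξ t)) (Measure.dirac θstar)
                ≤ ENNReal.ofReal (C * SGP.rateA κ μ ρ t) := by
  have hF := hV.feller
  have hprob := hF.isProb
  have hπ : IsProbabilityMeasure π := hV.invariant.1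
  obtain ⟨θstar, h0⟩ := hconv.exists_integral_grad_eq_zero hκ hf
  have hmin := hconv.fullTarget_add_le hf h0
  obtain ⟨C, hC, R, hR0, hRlim, hbound⟩ :=
    SGP.exists_integral_norm_sq_le hF hV.unique hf hκ hconv h0
  -- relative step size, kept below the stability threshold of the energy recursion
  let lam : ℝ := min 1 (1 / (2 * κ))
  have hlam : 0 < lam := lt_min one_pos (by positivity)
  have hlam1 : lam ≤ 1 := min_le_left _ _
  have hlamκ : 2 * κ * lam ≤ 1 := by
    have := mul_le_mul_of_nonneg_left (min_le_right 1 (1 / (2 * κ)))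
      (by positivity : 0 ≤ 2 * κ)
    rwa [mul_one_div_cancel (by positivity)] at this
  -- A slow step `lam * √ε` lasts `lam / √ε` in fast time at rate `1/ε`. Both the step and the
  -- averaging error then vanish; the factor `1/2` leaves room for rounding the step length.
  let b : ℝ → ℝ := fun ε => Real.sqrt ε + R (lam / 2 * (Real.sqrt ε)⁻¹)
  have hblim : Tendsto b (𝓝[>] 0) (𝓝 0) := by
    have h1 : Tendsto Real.sqrt (𝓝[>] 0) (𝓝[>] 0) := by
      refine tendsto_nhdsWithin_iff.2 ⟨?_, ?_⟩
      · simpa using (Real.continuous_sqrt.tendsto 0).mono_left nhdsWithin_le_nhds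
      · filter_upwards [self_mem_nhdsWithin] with ε hε using Real.sqrt_pos.2 hε
    have h2 := hRlim.comp ((tendsto_inv_nhdsGT_zero.comp h1).const_mul_atTop (half_pos hlam))
    simpa using (h1.mono_right nhdsWithin_le_nhds).add h2
  have hb0 : ∀ ε, 0 ≤ b ε := fun ε => add_nonneg (Real.sqrt_nonneg _) (hR0 _)
  -- The cut-off `c = b^(1/3)` balances the two terms of `c + C * b / c²`, which bounds the distance
  -- through Chebyshev's inequality.
  let ρ : ℝ → ℝ := fun ε => min 1 ((1 + C) * b ε ^ (1 / 3 : ℝ))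
  have hρ0 : ∀ ε, 0 ≤ ρ ε := fun ε => le_min zero_le_one
    (mul_nonneg (by positivity) (Real.rpow_nonneg (hb0 ε) _))
  have hρlim : Tendsto ρ (𝓝[>] 0) (𝓝 0) := by
    have h1 : Tendsto (fun ε => (1 + C) * b ε ^ (1 / 3 : ℝ)) (𝓝[>] 0) (𝓝 0) := by
      simpa using (hblim.rpow_const (p := 1 / 3) (Or.inr (by norm_num))).const_mul (1 + C)
    have := tendsto_const_nhds (x := (1 : ℝ)).min h1
    rwa [min_eq_right zero_le_one] at this
  refine ⟨θstar, fun θ => ?_, fun θ' hθ' => ?_, ρ, fun ε _ => ⟨hρ0 ε, min_le_left _ _⟩, hρlim,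
    fun ε hε Pst hst => ?_, fun μ hμ => ⟨hμ.tendsto_rateA hκ hρlim, fun θ₀ => ?_⟩⟩
  · have := hmin θ
    have h1 : 0 ≤ κ / 2 * ‖θ - θstar‖ ^ 2 := by positivity
    linarith
  · have h1 := hmin θ'
    have h2 := hθ' θstar
    have h3 : ‖θ' - θstar‖ ^ 2 ≤ 0 := by
      by_contra! h
      have : 0 < κ / 2 * ‖θ' - θstar‖ ^ 2 := by positivity
      linarith
    have h4 : ‖θ' - θstar‖ = 0 := by
      exact pow_eq_zero_iff two_ne_zero |>.1 (le_antisymm h3 (sq_nonneg _))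
    exact sub_eq_zero.1 (norm_eq_zero.1 h4)
  · have hPst := hst.1
    have hPstm : IsProbabilityMeasure (Pst.map Prod.fst) :=
      Measure.isProbabilityMeasure_map measurable_fst.aemeasurable
    have hsq : 0 < Real.sqrt ε := Real.sqrt_pos.2 hε.1
    have hbpos : 0 < b ε := add_pos_of_pos_of_nonneg hsq (hR0 _)
    simp only [ρ]
    rw [ENNReal.ofReal_min]
    refine le_min ?_ ?_
    · simpa using SGP.wasserstein_dirac_le_one (Pst.map Prod.fst) θstar
    let c : ℝ := b ε ^ (1 / 3 : ℝ)
    have hc : 0 < c := Real.rpow_pos_of_pos hbpos _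
    have hc3 : c ^ 3 = b ε := by
      rw [← Real.rpow_natCast, ← Real.rpow_mul hbpos.le]
      norm_num
    have hch := hst.measure_lt_le (θstar := θstar) (D := C * b ε) ?_ hc
    · refine (SGP.wasserstein_dirac_le _ θstar).trans
        ((SGP.lintegral_min_one_norm_le_add _ θstar (c := c)).trans ?_)
      refine (add_le_add_right hch _).trans (le_of_eq ?_)
      rw [← ENNReal.ofReal_add hc.le (by positivity)]
      congr 1
      change c + C * b ε / c ^ 2 = (1 + C) * c
      rw [← hc3]
      field_simp
    · intro N η hη
      obtain ⟨t₀, ht₀, hN⟩ := hbound N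
      let h : ℝ := lam * Real.sqrt ε
      have hh : 0 < h := mul_pos hlam hsq
      have hsq1 : Real.sqrt ε ≤ 1 := Real.sqrt_le_one.2 hε.2.le
      have hexp : Tendsto (fun n : ℕ => C * Real.exp (-2 * κ * (n * h))) atTop (𝓝 0) := by
        have h1 : Tendsto (fun n : ℕ => -2 * κ * (n * h)) atTop atBot :=
          (tendsto_natCast_atTop_atTop.atTop_mul_const hh).const_mul_atTop_of_neg
            (by linarith)
        simpa using (Real.tendsto_exp_atBot.comp h1).const_mul C
      obtain ⟨n, hn⟩ := (hexp.eventually (ge_mem_nhds hη)).exists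
      refine ⟨(t₀ + n * h).toNNReal, fun θ₀ hθ₀ ξ hξ x => ?_⟩
      have hL : lam / 2 * (Real.sqrt ε)⁻¹ ≤ h * ε⁻¹ := by
        have h1 : h * ε⁻¹ = lam * (Real.sqrt ε)⁻¹ := by
          have : ε = Real.sqrt ε * Real.sqrt ε := (Real.mul_self_sqrt hε.1.le).symm
          simp only [h]
          nth_rewrite 2 [this]
          field_simp
        rw [h1]
        gcongr
        linarith
      obtain ⟨hi, hle⟩ := hN _ _ (SGP.isTimeChange_const hε.1) θ₀ hθ₀ ξ hξ t₀ h
        (lam / 2 * (Real.sqrt ε)⁻¹) n le_rfl hh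
        (by
          have h1 : h ≤ lam := mul_le_of_le_one_right hlam.le hsq1
          have h2 : 2 * κ * h ≤ 2 * κ * lam := by gcongr
          linarith) (by positivity) hL
        (by have := inv_pos.2 hε.1; linarith) x
      refine ⟨hi, hle.trans ?_⟩
      rw [sub_self, zero_div, add_zero]
      have h1 : h ≤ Real.sqrt ε := mul_le_of_le_one_left hsq.le hlam1
      have h2 : C * h ≤ C * Real.sqrt ε := by gcongr
      simp only [b]
      linarith
  -- The constant is independent of `θ₀` and `μ`; their influence goes into the threshold `T`,
  -- through `t₀` and the eventual conditions on `μ`.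
  · refine ⟨Real.sqrt (2 * C), by positivity, fun ξ hξ a => ?_⟩
    obtain ⟨t₀, ht₀, hN⟩ := hbound ‖θ₀ - θstar‖
    have hhalf : Tendsto (fun t : ℝ => t / 2) atTop atTop :=
      tendsto_id.atTop_div_const (by norm_num)
    have hμhalf := hμ.tendsto.comp hhalf
    have hεlim : Tendsto (fun t => 1 / μ (t / 2)) atTop (𝓝[>] 0) := by
      simp only [one_div]
      exact tendsto_inv_atTop_nhdsGT_zero.comp hμhalf
    obtain ⟨T₁, hT₁⟩ := eventually_atTop.1 ((hhalf.eventually_ge_atTop t₀).and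
      ((hhalf.eventually_ge_atTop 1).and ((hμhalf.eventually_ge_atTop 1).and
        ((hμ.tendsto_increment.eventually (ge_mem_nhds one_half_pos)).and
          ((hblim.comp hεlim).eventually (ge_mem_nhds one_pos))))))
    refine ⟨max T₁ 1, lt_max_of_lt_right one_pos, fun t ht => ?_⟩
    obtain ⟨hs, ht1, hμ1, hinc, hb1⟩ := hT₁ t ((le_max_left _ _).trans ht.le)
    simp only [Function.comp_apply] at hμ1 hb1
    have hξt : Measurable (ξ t) := SGP.IsGradientProcess.measurable hξ t
    let ε : ℝ := 1 / μ (t / 2)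
    have ht0 : (0 : ℝ) < t := by linarith
    have hμs : 0 < μ (t / 2) := by linarith
    have hμt : 0 < μ t := hμ.pos t ht0.le
    have hε0 : 0 < ε := by positivity
    have hε1 : ε ≤ 1 := (div_le_one hμs).2 hμ1
    have hsq : 0 < Real.sqrt ε := Real.sqrt_pos.2 hε0
    have hsq1 : Real.sqrt ε ≤ 1 := Real.sqrt_le_one.2 hε1
    have hstep1 : lam * Real.sqrt ε ≤ 1 := by nlinarith
    -- The energy estimate is run on `[t/2, t]`: the first half brings the path into the absorbing
    -- ball, and on the second the rate is at least `1/ε`.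
    obtain ⟨n, h, hh, hnh, hhu, hhl⟩ := SGP.exists_nat_mul_eq (a := t / 2)
      (b := lam * Real.sqrt ε) (mul_pos hlam hsq) (hstep1.trans ht1)
    have hsum : (t : ℝ) / 2 + n * h = t := by rw [hnh]; ring
    have hmt : μ t ≤ 2 * μ (t / 2) := by
      rw [div_le_iff₀ hμt] at hinc
      linarith
    let U : ℝ := (μ t - μ (t / 2)) / μ t
    have hinc0 : 0 ≤ μ t - μ (t / 2) :=
      sub_nonneg.2 (hμ.mono (show (0 : ℝ) ≤ t / 2 by linarith) ht0.le (by linarith))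
    have hU0 : 0 ≤ U := div_nonneg hinc0 hμt.le
    have hms : μ (max ((t : ℝ) / 2) 0) = μ (t / 2) := by rw [max_eq_left (by linarith)]
    have hmst : μ (max ((t : ℝ) / 2 + n * h) 0) = μ t := by rw [hsum, max_eq_left ht0.le]
    have hL : lam / 2 * (Real.sqrt ε)⁻¹ ≤ h * μ (max ((t : ℝ) / 2) 0) := by
      rw [hms]
      have h1 : μ (t / 2) = (Real.sqrt ε)⁻¹ * (Real.sqrt ε)⁻¹ := by
        rw [← mul_inv, Real.mul_self_sqrt hε0.le]
        simp [ε]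
      calc lam / 2 * (Real.sqrt ε)⁻¹ = lam * Real.sqrt ε / 2 * μ (t / 2) := by
            rw [h1]; field_simp
        _ ≤ _ := by gcongr
    have henergy : ∀ x, Integrable (fun ω => ‖ξ t ω - θstar‖ ^ 2) (P x) ∧
        ∫ ω, ‖ξ t ω - θstar‖ ^ 2 ∂(P x) ≤ 2 * C * (Real.exp (-κ * t) + U + b ε) := by
      intro x
      obtain ⟨hi, hle⟩ := hN _ _ hμ.isTimeChange θ₀ le_rfl ξ hξ (t / 2) h
        (lam / 2 * (Real.sqrt ε)⁻¹) n hs hh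
        (by
          have h1 : h ≤ lam := hhu.trans (mul_le_of_le_one_right hlam.le hsq1)
          have h2 : 2 * κ * h ≤ 2 * κ * lam := by gcongr
          linarith) (by positivity) hL (by rw [hms, hmst]; exact hmt) x
      rw [hms, hmst] at hle
      rw [hsum, Real.toNNReal_coe] at hi hle
      refine ⟨hi, hle.trans ?_⟩
      -- Changing the denominator from `μ (t / 2)` to `μ t` costs the factor `2` of `hmt`.
      have h1 : (μ t - μ (t / 2)) / μ (t / 2) ≤ 2 * U := by
        simp only [U]
        rw [← mul_div_assoc, div_le_div_iff₀ hμs hμt]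
        nlinarith
      have h2 : h ≤ Real.sqrt ε := hhu.trans (mul_le_of_le_one_left hsq.le hlam1)
      have h3 : -2 * κ * (n * h) = -κ * t := by rw [hnh]; ring
      have h4 := hR0 (lam / 2 * (Real.sqrt ε)⁻¹)
      have h5 := (Real.exp_pos (-κ * t)).le
      rw [h3, mul_comm 2 C, mul_assoc]
      refine mul_le_mul_of_nonneg_left ?_ hC.le
      simp only [b]
      linarith
    have hrate : Real.sqrt (2 * C * (Real.exp (-κ * t) + U + b ε)) ≤
        Real.sqrt (2 * C) * SGP.rateA κ μ ρ t := by
      rw [Real.sqrt_mul (by positivity)]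
      refine mul_le_mul_of_nonneg_left ?_ (Real.sqrt_nonneg _)
      refine (SGP.sqrt_add_add_le (Real.exp_pos _).le hU0 (hb0 ε)).trans ?_
      have h1 : Real.sqrt (Real.exp (-κ * t)) ≤ Real.exp (-κ * t / 8) := by
        rw [← Real.exp_half]
        refine Real.exp_le_exp.2 ?_
        nlinarith
      have h2 : Real.sqrt (b ε) ≤ ρ ε := by
        refine le_min (Real.sqrt_le_one.2 hb1) ((SGP.sqrt_le_rpow_third (hb0 ε) hb1).trans ?_)
        exact le_mul_of_one_le_left (Real.rpow_nonneg (hb0 ε) _) (by linarith)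
      exact add_le_add (add_le_add_left h1 _) h2
    have hpoint : ∀ x, ∫⁻ ω, ENNReal.ofReal (min 1 ‖ξ t ω - θstar‖) ∂(P x) ≤
        ENNReal.ofReal (Real.sqrt (2 * C) * SGP.rateA κ μ ρ t) := fun x =>
      (SGP.lintegral_min_one_norm_le (hξt.sub_const θstar) (henergy x).1).trans
        (ENNReal.ofReal_le_ofReal ((Real.sqrt_le_sqrt (henergy x).2).trans hrate))
    have hlaw : IsProbabilityMeasure (SGP.lawFrom P π) := by
      unfold SGP.lawFrom; infer_instance
    refine ⟨(SGP.wasserstein_map_dirac_le hξt θstar).trans ?_,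
      (SGP.wasserstein_map_dirac_le hξt θstar).trans (hpoint a)⟩
    -- The bound `hpoint` is uniform in the starting point, so it survives integration against `π`.
    rw [SGP.lawFrom, Measure.lintegral_bind P.measurable.aemeasurable
      (Measurable.aemeasurable (by fun_prop))]
    calc _ ≤ ∫⁻ _x, ENNReal.ofReal (Real.sqrt (2 * C) * SGP.rateA κ μ ρ t) ∂π :=
          lintegral_mono hpoint
      _ = _ := by simp
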